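/- Let $(M,J)$ be a finite-dimensional smooth manifold without boundary with a smooth almost complex structure, and let $\Sigma\subset M$ be an embedded almost complex hypersurface, i.e. a smoothly embedded submanifold of real codimension two with $J(T\Sigma)=T\Sigma$; assume that $\Sigma$ is closed as a subset of $M$. Let $\mathbf\Delta\subset\mathbb C$ be the unit disc (open or closed), and let $u:\mathbf\Delta\to M$ be a pseudoholomorphic curve, i.e. a continuous map which on the open disc $\mathring{\mathbf\Delta}$ is of class $C^2$ and satisfies $du\circ i=J\circ du$. Then either $u(\mathbf\Delta)\subset\Sigma$, or $u^{-1}(\Sigma)\cap\mathring{\mathbf\Delta}$ is a discrete subset of the open disc, without accumulation points in $\mathring{\mathbf\Delta}$, each point of which has a finite positive intersection index. More precisely, call a smooth function $\zeta:U\to\mathbb C$ on an open neighbourhood $U$ of $p\in\Sigma$ a *normal coordinate* of $\Sigma$ near $p$ if $\zeta^{-1}(0)=U\cap\Sigma$ and if, at each $x\in U\cap\Sigma$, the differential $d\zeta_x:T_xM\to\mathbb C$ is surjective and complex linear, $d\zeta_x\circ J_x=i\,d\zeta_x$. The intersection index of $u$ with $\Sigma$ at an intersection point $z_0$ is $k\in\mathbb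 Z$ if, for every normal coordinate $\zeta$ near $u(z_0)$, the normal component $\zeta\circ u$ has winding number $k$ about $0$ along all sufficiently small circles about $z_0$. In the second case, for every $z_0\in\mathring{\mathbf\Delta}$ with $u(z_0)\in\Sigma$ there is an integer $m\ge 1$ such that 1. the intersection index of $u$ with $\Sigma$ at $z_0$ is $m$, and no other integer; 2. there is a normal coordinate $\zeta$ near $u(z_0)$ with $\zeta(u(z_0+\xi))=\xi^m+O(|\xi|^{m+1})$ as $\xi\to0$; 3. for every normal coordinate $\zeta$ near $u(z_0)$ there is $a\in\mathbb C\setminus\{0\}$ with $\zeta(u(z_0+\xi))=a\,\xi^m+O(|\xi|^{m+1})$ as $\xi\to0$. -/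

import Mathlib

open Set Filter Topology Manifold Asymptotics
open scoped ContDiff

/-- A smooth almost complex structure on a smooth manifold `M` modelled on the real normed space
`E`: a smooth section `J` of the endomorphism bundle `Hom(TM, TM)` with `J ∘ J = -id`. -/
structure AlmostComplexStructure (E : Type*) [NormedAddCommGroup E] [NormedSpace ℝ E]
    (M : Type*) [TopologicalSpace M] [ChartedSpace E M] [IsManifold 𝓘(ℝ, E) ∞ M] where
  /-- The endomorphism of each tangent space. -/
  toFun : ∀ x : M, TangentSpace 𝓘(ℝ, E) x →L[ℝ] TangentSpace 𝓘(ℝ, E) x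
  sq_eq_neg : ∀ (x : M) (v : TangentSpace 𝓘(ℝ, E) x), toFun x (toFun x v) = -v
  smooth : ContMDiff 𝓘(ℝ, E) (𝓘(ℝ, E).prod 𝓘(ℝ, E →L[ℝ] E)) ∞
    (fun x : M => Bundle.TotalSpace.mk' (E →L[ℝ] E)
      (E := fun x : M => TangentSpace 𝓘(ℝ, E) x →L[ℝ] TangentSpace 𝓘(ℝ, E) x) x (toFun x))

section

variable {E : Type*} [NormedAddCommGroup E] [NormedSpace ℝ E]
  {M : Type*} [TopologicalSpace M] [ChartedSpace E M] [IsManifold 𝓘(ℝ, E) ∞ M]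

/-- `ι : S → M` exhibits (the image of) `S` as an embedded almost complex hypersurface of `(M, J)`:
it is a smooth embedding of real codimension two whose tangent spaces are invariant under `J`. -/
structure IsAlmostComplexHypersurface (J : AlmostComplexStructure E M)
    (F : Type*) [NormedAddCommGroup F] [NormedSpace ℝ F]
    {S : Type*} [TopologicalSpace S] [ChartedSpace F S] (ι : S → M) : Prop where
  embedding : IsSmoothEmbedding 𝓘(ℝ, F) 𝓘(ℝ, E) ∞ ι
  codim : Module.finrank ℝ F + 2 = Module.finrank ℝ E
  invariant : ∀ (s : S) (v : TangentSpace 𝓘(ℝ, F) s), ∃ w : TangentSpace 𝓘(ℝ, F) s,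
    mfderiv 𝓘(ℝ, F) 𝓘(ℝ, E) ι s w = J.toFun (ι s) (mfderiv 𝓘(ℝ, F) 𝓘(ℝ, E) ι s v)

/-- `u` is a `J`-holomorphic curve of class `C²` on the open set `Ω ⊆ ℂ`:
`du ∘ i = J ∘ du` at each point of `Ω`. -/
structure IsPseudoholomorphicOn (J : AlmostComplexStructure E M) (u : ℂ → M) (Ω : Set ℂ) :
    Prop where
  contMDiffOn : ContMDiffOn 𝓘(ℝ, ℂ) 𝓘(ℝ, E) 2 u Ω
  holomorphic : ∀ z ∈ Ω, ∀ v : ℂ,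
    mfderiv 𝓘(ℝ, ℂ) 𝓘(ℝ, E) u z (Complex.I * v : ℂ) =
      J.toFun (u z) (mfderiv 𝓘(ℝ, ℂ) 𝓘(ℝ, E) u z v)

/-- `ζ` is a normal coordinate of `A ⊆ M` on the open neighbourhood `U` of `p`: a smooth complex
valued function on `U` which cuts out `A` regularly, and whose differential at the points of `A`
is complex linear, so that it identifies the normal spaces of `A` with `ℂ` as complex lines. -/
structure IsNormalCoordinate (J : AlmostComplexStructure E M) (A : Set M) (p : M)
    (U : Set M) (ζ : M → ℂ) : Prop where
  isOpen : IsOpen U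
  mem : p ∈ U
  contMDiffOn : ContMDiffOn 𝓘(ℝ, E) 𝓘(ℝ, ℂ) ∞ ζ U
  eq_zero_iff : ∀ x ∈ U, ζ x = 0 ↔ x ∈ A
  surjective : ∀ x ∈ U ∩ A, Function.Surjective (mvfderiv 𝓘(ℝ, E) ζ x)
  complexLinear : ∀ x ∈ U ∩ A, ∀ v : TangentSpace 𝓘(ℝ, E) x,
    mvfderiv 𝓘(ℝ, E) ζ x (J.toFun x v) = Complex.I * mvfderiv 𝓘(ℝ, E) ζ x v

/-- The loop `γ : [0, 2π] → ℂ ∖ {0}` (given as a function on `ℝ`) has winding number `k` about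
`0`: its argument has a continuous determination which increases by `2πk`. -/
def HasWindingNumber (γ : ℝ → ℂ) (k : ℤ) : Prop :=
  ∃ θ : ℝ → ℝ, Continuous θ ∧
    (∀ t ∈ Icc 0 (2 * Real.pi), γ t ≠ 0 ∧ γ t = ‖γ t‖ * Complex.exp (θ t * Complex.I)) ∧
    θ (2 * Real.pi) = θ 0 + 2 * Real.pi * k

/-- The local intersection index of `u` with `A` at `z₀` is `k`: in every normal coordinate `ζ` of
`A` near `u z₀`, the normal component `ζ ∘ u` winds `k` times about `0` along all sufficiently
small circles about `z₀`. -/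
def HasIntersectionIndex (J : AlmostComplexStructure E M) (A : Set M) (u : ℂ → M) (z₀ : ℂ)
    (k : ℤ) : Prop :=
  ∀ (U : Set M) (ζ : M → ℂ), IsNormalCoordinate J A (u z₀) U ζ →
    ∀ᶠ r in 𝓝[>] (0 : ℝ), HasWindingNumber (fun t => ζ (u (circleMap z₀ r t))) k

end

/-!
# Intersections of a pseudoholomorphic curve with an almost complex hypersurface

Let `ζ` be a normal coordinate of the hypersurface near an intersection point `u z₀` and
`w = ζ ∘ u` the normal component of the curve. The map `x ↦ dζ_x ∘ J_x - i dζ_x` measures how far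
`ζ` is from being `J`-holomorphic. It vanishes on the hypersurface `ζ = 0`, hence it is a fixed
linear function of `ζ` up to an error `O(|x - u z₀| |ζ x|)` (`exists_linear_factor`). Together with
the equation of the curve this says that `w` solves a perturbed Cauchy–Riemann equation
`2 ∂w/∂z̄ = A w + O(|z - z₀| |w|)` with `A` a constant real linear map
(`eventually_eq_zero_or_leading_monomial_comp`).

Such solutions behave like holomorphic functions (`eventually_eq_zero_or_leading_monomial`). If `w`
vanishes to order `k` then so does `∂w/∂z̄`, and the Cauchy–Pompeiu formula, whose first `k` moments
vanish, represents a cut-off of `w / z ^ k` as the Cauchy transform of a bounded function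
(`pow_mul_cauchyTransform`). Cauchy transforms of bounded functions are Hölder continuous, so `w`
has a leading coefficient at order `k`; subtracting an explicit particular solution of the equation
with the leading term on the right-hand side makes the density `O(|z| ^ (1/2))`, whose Cauchy
transform is Lipschitz at the origin, and this gives the error `O(|z| ^ (m + 1))`. If `w` vanishes
to infinite order, the same formula for all `k`, used on a disc so small that the Cauchy transform is
contracting, forces `w = 0` near the point (`eventually_eq_zero_of_infinite_order`).

Normal coordinates exist near every point of the hypersurface: in a slice chart the defining linear
map is composed with identifications of the normal planes, with the complex structures induced by
`J`, with `ℂ` (`IsAlmostComplexHypersurface.exists_isNormalCoordinate`). Any two of them are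
comparable, so that the order `m` and the winding number do not depend on the choice. The global
dichotomy follows from the local one because the disc is connected.
-/

section Analysis

open MeasureTheory

/-! ### The Cauchy–Pompeiu formula -/

/-- Twice the Cauchy–Riemann operator, `2 ∂h/∂z̄ = ∂h/∂x + i ∂h/∂y`. -/
noncomputable def dbarTwo (h : ℂ → ℂ) (z : ℂ) : ℂ :=
  fderiv ℝ h z 1 + Complex.I * fderiv ℝ h z Complex.I

lemma continuous_dbarTwo {h : ℂ → ℂ} (hh : ContDiff ℝ 1 h) : Continuous (dbarTwo h) := by
  have := hh.continuous_fderiv one_ne_zero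
  unfold dbarTwo
  fun_prop

lemma apply_add_I_mul_apply_I_mul (T : ℂ →L[ℝ] ℂ) (e : ℂ) :
    T e + Complex.I * T (Complex.I * e) = star e * (T 1 + Complex.I * T Complex.I) := by
  have h1 : T e = e.re * T 1 + e.im * T Complex.I := by
    conv_lhs => rw [show e = e.re • (1 : ℂ) + e.im • Complex.I by simp [Complex.re_add_im]]
    rw [map_add, map_smul, map_smul]; simp
  have h2 : T (Complex.I * e) = -e.im * T 1 + e.re * T Complex.I := by
    conv_lhs => rw [show Complex.I * e = (-e.im) • (1 : ℂ) + e.re • Complex.I by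
      apply Complex.ext <;> simp]
    rw [map_add, map_smul, map_smul]; simp
  have h3 : star e = e.re - e.im * Complex.I := by
    apply Complex.ext <;> simp
  rw [h1, h2, h3]
  ring_nf
  simp only [Complex.I_sq]
  ring

/-- The Cauchy–Pompeiu formula at the origin for a compactly supported `C¹` function: in polar
coordinates the integrand is the sum of a radial and of an angular derivative of `h`. -/
lemma integral_dbarTwo_div {h : ℂ → ℂ} (hh : ContDiff ℝ 1 h) (hc : HasCompactSupport h) :
    ∫ z, dbarTwo h z / z = -(2 * Real.pi) * h 0 := by
  obtain ⟨R, hR0, hR⟩ : ∃ R : ℝ, 0 < R ∧ tsupport h ⊆ Metric.ball 0 R := by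
    obtain ⟨R, hR⟩ := hc.isBounded.subset_ball (0 : ℂ)
    exact ⟨max R 1, by positivity, hR.trans (Metric.ball_subset_ball (le_max_left _ _))⟩
  set e : ℝ → ℂ := fun t => Complex.exp (t * Complex.I) with he
  have hec : Continuous e := by fun_prop
  have hnorm : ∀ t, ‖e t‖ = 1 := fun t => Complex.norm_exp_ofReal_mul_I t
  have hfd := hh.continuous_fderiv one_ne_zero
  have hout : ∀ z : ℂ, R ≤ ‖z‖ → h z = 0 ∧ fderiv ℝ h z = 0 := fun z hz => by
    have hz' : z ∉ tsupport h := fun hz' => by simpa using not_lt.2 hz (by simpa using hR hz')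
    exact ⟨image_eq_zero_of_notMem_tsupport hz',
      image_eq_zero_of_notMem_tsupport fun h' => hz' (tsupport_fderiv_subset ℝ h')⟩
  set gr : ℝ × ℝ → ℂ := fun p => fderiv ℝ h (p.1 * e p.2) (e p.2)
  set ga : ℝ × ℝ → ℂ := fun p => fderiv ℝ h (p.1 * e p.2) (Complex.I * e p.2)
  have hgr : Continuous gr := by fun_prop
  have hga : Continuous ga := by fun_prop
  set s : Set (ℝ × ℝ) := Ioc 0 R ×ˢ Ioc (-Real.pi) Real.pi
  have hint : ∀ g : ℝ × ℝ → ℂ, Continuous g → IntegrableOn g s := fun g hg =>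
    (hg.continuousOn.integrableOn_compact (isCompact_Icc.prod isCompact_Icc)).mono_set
      (prod_mono Ioc_subset_Icc_self Ioc_subset_Icc_self)
  have hs : MeasurableSet s := measurableSet_Ioc.prod measurableSet_Ioc
  have step1 : ∫ z, dbarTwo h z / z = ∫ p in s, (gr p + Complex.I * ga p) := by
    rw [← Complex.integral_comp_polarCoord_symm, polarCoord_target]
    have : (Ioi (0 : ℝ) ×ˢ Ioo (-Real.pi) Real.pi : Set (ℝ × ℝ)) =ᵐ[volume]
        (Ioi (0 : ℝ) ×ˢ Ioc (-Real.pi) Real.pi : Set (ℝ × ℝ)) :=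
      Measure.set_prod_ae_eq (Filter.EventuallyEq.rfl) Ioo_ae_eq_Ioc
    rw [setIntegral_congr_set this]
    rw [setIntegral_eq_of_subset_of_forall_sdiff_eq_zero (s := s)
      (measurableSet_Ioi.prod measurableSet_Ioc) (prod_mono Ioc_subset_Ioi_self subset_rfl)]
    · refine setIntegral_congr_fun hs fun p hp => ?_
      have hp0 : (p.1 : ℂ) ≠ 0 := by exact_mod_cast hp.1.1.ne'
      have hz : (Complex.polarCoord.symm p : ℂ) = p.1 * e p.2 := by
        rw [Complex.polarCoord_symm_apply]; simp [he, Complex.exp_mul_I]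
      have hee : star (e p.2) * e p.2 = 1 := by
        have := Complex.conj_mul' (e p.2)
        rw [hnorm] at this; simpa using this
      have he0 : e p.2 ≠ 0 := Complex.exp_ne_zero _
      simp only [hz, gr, ga, apply_add_I_mul_apply_I_mul, dbarTwo, Complex.real_smul]
      field_simp
      linear_combination (-(fderiv ℝ h (p.1 * e p.2) 1 +
        Complex.I * fderiv ℝ h (p.1 * e p.2) Complex.I)) * hee
    · rintro p ⟨hp1, hp2⟩
      have : R ≤ ‖(Complex.polarCoord.symm p : ℂ)‖ := by
        rw [Complex.norm_polarCoord_symm, abs_of_pos hp1.1]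
        by_contra hlt
        exact hp2 ⟨⟨hp1.1, (not_le.1 hlt).le⟩, hp1.2⟩
      simp only [dbarTwo]
      rw [(hout _ this).2]
      simp
  have step2 : ∫ p in s, gr p = -(2 * Real.pi) * h 0 := by
    have : ∫ p in s, gr p = ∫ t in Ioc (-Real.pi) Real.pi, ∫ r in Ioc 0 R, gr (r, t) := by
      have h1 := hint gr hgr
      rw [IntegrableOn, Measure.volume_eq_prod, ← Measure.prod_restrict] at h1
      rw [Measure.volume_eq_prod, ← Measure.prod_restrict, integral_prod_symm _ h1]
    rw [this]
    have h2 : ∀ t, ∫ r in Ioc 0 R, gr (r, t) = -h 0 := fun t => by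
      rw [← intervalIntegral.integral_of_le hR0.le,
        intervalIntegral.integral_eq_sub_of_hasDerivAt (f := fun r : ℝ => h (r * e t))]
      · simp [(hout (R * e t) (by simp [hnorm, abs_of_pos hR0])).1]
      · intro r _
        have h3 : HasDerivAt (fun r : ℝ => (r : ℂ) * e t) (e t) r := by
          simpa using (Complex.ofRealCLM.hasDerivAt (x := r)).mul_const (e t)
        exact ((hh.differentiable one_ne_zero _).hasFDerivAt.comp_hasDerivAt r h3)
      · exact (by fun_prop : Continuous fun r => gr (r, t)).intervalIntegrable _ _
    simp_rw [h2]
    rw [setIntegral_const]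
    simp [Measure.real, Real.pi_pos.le]
    ring_nf
    norm_num
  have step3 : ∫ p in s, ga p = 0 := by
    rw [Measure.volume_eq_prod, setIntegral_prod _ (by exact hint ga hga)]
    refine setIntegral_eq_zero_of_forall_eq_zero fun r hr => ?_
    have hr0 : (r : ℂ) ≠ 0 := by exact_mod_cast hr.1.ne'
    have h4 : ∫ t in Ioc (-Real.pi) Real.pi, (r : ℂ) * ga (r, t) = 0 := by
      rw [← intervalIntegral.integral_of_le (by linarith [Real.pi_pos]),
        intervalIntegral.integral_eq_sub_of_hasDerivAt (f := fun t : ℝ => h (r * e t))]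
      · simp [he]
      · intro t _
        have h3 : HasDerivAt (fun t : ℝ => (r : ℂ) * e t) (r * (e t * Complex.I)) t := by
          have := ((Complex.ofRealCLM.hasDerivAt (x := t)).mul_const Complex.I).cexp
          simpa using this.const_mul (r : ℂ)
        have h5 := ((hh.differentiable one_ne_zero _).hasFDerivAt.comp_hasDerivAt t h3)
        have h6 : (r : ℂ) * ga (r, t) =
            fderiv ℝ h (r * e t) (r * (e t * Complex.I)) := by
          have := (fderiv ℝ h (r * e t)).map_smul r (Complex.I * e t)
          rw [Complex.real_smul, Complex.real_smul] at this
          rw [mul_comm (e t)]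
          exact this.symm
        rw [h6]
        exact h5
      · exact (by fun_prop : Continuous fun t => (r : ℂ) * ga (r, t)).intervalIntegrable _ _
    rw [integral_const_mul] at h4
    exact (mul_eq_zero.1 h4).resolve_left hr0
  rw [step1, integral_add (hint gr hgr) ((hint ga hga).const_mul _), integral_const_mul, step2,
    step3, mul_zero, add_zero]

lemma integral_dbarTwo_div_sub {h : ℂ → ℂ} (hh : ContDiff ℝ 1 h) (hc : HasCompactSupport h)
    (ζ : ℂ) : ∫ z, dbarTwo h z / (z - ζ) = -(2 * Real.pi) * h ζ := by
  have h1 := integral_dbarTwo_div (h := fun z => h (z + ζ)) (hh.comp (by fun_prop))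
    (hc.comp_homeomorph (Homeomorph.addRight ζ))
  have h2 : ∀ z, dbarTwo (fun z => h (z + ζ)) z = dbarTwo h (z + ζ) := fun z => by
    simp only [dbarTwo, fderiv_comp_add_right]
  rw [← integral_add_right_eq_self _ ζ]
  simpa [h2] using h1

/-! ### Estimates for the Cauchy transform -/

/-- The function `‖z‖ ^ (-3/2)`, which dominates all the singular kernels below. -/
noncomputable def radialKernel (z : ℂ) : ℝ := (√‖z‖ ^ 3)⁻¹

lemma radialKernel_nonneg (z : ℂ) : 0 ≤ radialKernel z := by unfold radialKernel; positivity

lemma measurable_radialKernel : Measurable radialKernel := by unfold radialKernel; fun_prop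

lemma integrableOn_radialKernel (R : ℝ) : IntegrableOn radialKernel (Metric.ball 0 R) := by
  rw [← integrable_indicator_iff Metric.isOpen_ball.measurableSet]
  have h1 : (Metric.ball (0 : ℂ) R).indicator radialKernel =
      fun z => (Iio R).indicator (fun y : ℝ => (√y ^ 3)⁻¹) ‖z‖ := by
    ext z
    simp [indicator, radialKernel]
  rw [h1, integrable_fun_norm_addHaar]
  simp only [Complex.finrank_real_complex]
  have h2 : IntegrableOn (fun y : ℝ => y ^ (-(1 / 2) : ℝ)) (Ioo 0 R) := by
    rcases le_or_gt R 0 with hR | hR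
    · simp [Ioo_eq_empty_of_le hR]
    · exact (intervalIntegral.integrableOn_Ioo_rpow_iff hR).2 (by norm_num)
  have h3 : IntegrableOn (fun y : ℝ => (Iio R).indicator (fun y : ℝ => y ^ (-(1 / 2) : ℝ)) y)
      (Ioi 0) := by
    rw [integrableOn_indicator_iff measurableSet_Iio, inter_comm, Ioi_inter_Iio]
    exact h2
  refine h3.congr_fun (fun y hy => ?_) measurableSet_Ioi
  have hy : (0 : ℝ) < y := hy
  by_cases hyR : y < R
  · have : √y ≠ 0 := (Real.sqrt_pos.2 hy).ne'
    simp only [indicator, mem_Iio, hyR, if_true, smul_eq_mul]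
    rw [Real.rpow_neg hy.le, ← Real.sqrt_eq_rpow]
    field_simp
    rw [pow_one, Real.sq_sqrt hy.le]
  · simp [indicator, hyR]

lemma integrableOn_radialKernel_sub (R : ℝ) (ζ : ℂ) :
    IntegrableOn (fun z => radialKernel (z - ζ)) (Metric.ball 0 R) := by
  have h1 := (integrable_indicator_iff Metric.isOpen_ball.measurableSet).2
    (integrableOn_radialKernel (R + ‖ζ‖))
  have h2 := (h1.comp_sub_right ζ)
  refine Integrable.mono' h2.integrableOn
    (measurable_radialKernel.comp (measurable_id.sub_const ζ)).aestronglyMeasurable ?_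
  refine (ae_restrict_iff' Metric.isOpen_ball.measurableSet).2 (Eventually.of_forall fun z hz => ?_)
  have : z - ζ ∈ Metric.ball (0 : ℂ) (R + ‖ζ‖) := by
    rw [mem_ball_zero_iff] at hz ⊢
    linarith [norm_sub_le z ζ]
  rw [indicator_of_mem this, Real.norm_of_nonneg (radialKernel_nonneg _)]

lemma setIntegral_radialKernel_sub_le {R : ℝ} {ζ : ℂ} (hζ : ‖ζ‖ ≤ R) :
    ∫ z in Metric.ball 0 R, radialKernel (z - ζ) ≤
      ∫ z in Metric.ball 0 (2 * R), radialKernel z := by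
  have hm : MeasurableSet (Metric.ball (0 : ℂ) R) := Metric.isOpen_ball.measurableSet
  have hm2 : MeasurableSet (Metric.ball (0 : ℂ) (2 * R)) := Metric.isOpen_ball.measurableSet
  rw [← integral_indicator hm, ← integral_indicator hm2,
    ← integral_sub_right_eq_self ((Metric.ball (0 : ℂ) (2 * R)).indicator radialKernel) ζ]
  refine integral_mono ((integrable_indicator_iff hm).2 (integrableOn_radialKernel_sub R ζ))
    (((integrable_indicator_iff hm2).2 (integrableOn_radialKernel _)).comp_sub_right ζ)
    fun z => ?_
  by_cases hz : z ∈ Metric.ball (0 : ℂ) R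
  · have : z - ζ ∈ Metric.ball (0 : ℂ) (2 * R) := by
      rw [mem_ball_zero_iff] at hz ⊢
      linarith [norm_sub_le z ζ]
    simp only [indicator_of_mem hz, indicator_of_mem this, le_refl]
  · rw [indicator_of_notMem hz]
    exact indicator_nonneg (fun z _ => radialKernel_nonneg z) _

/-- The mass of the radial kernel on the ball of radius `2R`. -/
noncomputable def kernelMass (R : ℝ) : ℝ := ∫ z in Metric.ball (0 : ℂ) (2 * R), radialKernel z

lemma kernelMass_nonneg (R : ℝ) : 0 ≤ kernelMass R :=
  integral_nonneg fun z => radialKernel_nonneg z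

lemma kernelMass_mono {R R' : ℝ} (h : R ≤ R') : kernelMass R ≤ kernelMass R' :=
  setIntegral_mono_set (integrableOn_radialKernel _)
    (Eventually.of_forall fun z => radialKernel_nonneg z)
    (Metric.ball_subset_ball (by linarith)).eventuallyLE

/-- An integrand supported in the ball of radius `R` and dominated by the radial kernels centred
at `0` and at `ζ` is integrable, with the corresponding bound. -/
lemma integrable_of_le_radialKernel {Φ : ℂ → ℂ} (hm : AEStronglyMeasurable Φ) {R c : ℝ} {ζ : ℂ}
    (hc : 0 ≤ c) (hζ : ‖ζ‖ ≤ R) (hout : ∀ z, R ≤ ‖z‖ → Φ z = 0)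
    (hle : ∀ z, z ≠ 0 → z ≠ ζ → ‖z‖ < R →
      ‖Φ z‖ ≤ c * (radialKernel z + radialKernel (z - ζ))) :
    Integrable Φ ∧ ‖∫ z, Φ z‖ ≤ c * (2 * kernelMass R) := by
  have hb : MeasurableSet (Metric.ball (0 : ℂ) R) := Metric.isOpen_ball.measurableSet
  set B : ℂ → ℝ := (Metric.ball (0 : ℂ) R).indicator
    fun z => c * (radialKernel z + radialKernel (z - ζ))
  have hB : Integrable B := (integrable_indicator_iff hb).2
    (((integrableOn_radialKernel R).add (integrableOn_radialKernel_sub R ζ)).const_mul c)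
  have hae : ∀ᵐ z : ℂ, ‖Φ z‖ ≤ B z := by
    have h0 : ∀ᵐ z : ℂ, z ≠ 0 := by simp [ae_iff]
    have h1 : ∀ᵐ z : ℂ, z ≠ ζ := by simp [ae_iff]
    filter_upwards [h0, h1] with z hz0 hz1
    by_cases hz : z ∈ Metric.ball (0 : ℂ) R
    · simp only [B, indicator_of_mem hz]
      exact hle z hz0 hz1 (by simpa using hz)
    · simp only [B, indicator_of_notMem hz]
      rw [hout z (by simpa using hz), norm_zero]
  refine ⟨hB.mono' hm hae, (norm_integral_le_of_norm_le hB hae).trans ?_⟩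
  simp only [B]
  rw [integral_indicator hb, integral_const_mul,
    integral_add (integrableOn_radialKernel R) (integrableOn_radialKernel_sub R ζ)]
  refine mul_le_mul_of_nonneg_left ?_ hc
  have h1 : ∫ z in Metric.ball (0 : ℂ) R, radialKernel z ≤ kernelMass R := by
    simpa [kernelMass] using
      setIntegral_radialKernel_sub_le (R := R) (ζ := 0) (by simpa using (norm_nonneg ζ).trans hζ)
  have h2 := setIntegral_radialKernel_sub_le hζ
  rw [← kernelMass] at h2
  linarith

/-- The Cauchy transform of `F`, up to the factor `-1/π`. -/
noncomputable def cauchyTransform (F : ℂ → ℂ) (ζ : ℂ) : ℂ := ∫ z, F z / (z - ζ)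

section CauchyTransform

variable {F : ℂ → ℂ} {R K : ℝ}

lemma cauchyTransform_bound (hm : AEStronglyMeasurable F) (hK : 0 ≤ K)
    (hout : ∀ z, R ≤ ‖z‖ → F z = 0) (hF : ∀ z, ‖F z‖ ≤ K) {ζ : ℂ} (hζ : ‖ζ‖ ≤ R) :
    Integrable (fun z => F z / (z - ζ)) ∧
      ‖cauchyTransform F ζ‖ ≤ K * √(2 * R) * (2 * kernelMass R) := by
  refine integrable_of_le_radialKernel (hm.mul
    (by fun_prop : Measurable fun z : ℂ => (z - ζ)⁻¹).aestronglyMeasurable)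
    (by positivity) hζ (fun z hz => by simp [hout z hz]) fun z _ hz hzR => ?_
  have hb : 0 < ‖z - ζ‖ := norm_pos_iff.2 (sub_ne_zero.2 hz)
  have hbR : ‖z - ζ‖ ≤ 2 * R := by linarith [norm_sub_le z ζ]
  have hβ := Real.sqrt_pos.2 hb
  have h1 : ‖z - ζ‖⁻¹ ≤ √(2 * R) * radialKernel (z - ζ) := by
    have h2 := Real.sqrt_le_sqrt hbR
    rw [radialKernel, ← div_eq_mul_inv, le_div_iff₀ (by positivity)]
    nth_rewrite 1 [← Real.sq_sqrt hb.le]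
    have : (√‖z - ζ‖ ^ 2)⁻¹ * √‖z - ζ‖ ^ 3 = √‖z - ζ‖ := by field_simp
    rw [this]; exact h2
  simp only [Pi.mul_apply, norm_mul, norm_inv]
  calc ‖F z‖ * ‖z - ζ‖⁻¹ ≤ K * (√(2 * R) * radialKernel (z - ζ)) := by
        gcongr; exact hF z
    _ ≤ _ := by
        rw [mul_assoc]
        have := radialKernel_nonneg z
        gcongr
        linarith

/-- The difference quotient of the Cauchy transform at the origin. -/
lemma cauchyTransform_sub (hm : AEStronglyMeasurable F) (hK : 0 ≤ K)
    (hout : ∀ z, R ≤ ‖z‖ → F z = 0) (hF : ∀ z, ‖F z‖ ≤ K) {ζ : ℂ} (hζ : ‖ζ‖ ≤ R) :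
    cauchyTransform F ζ - cauchyTransform F 0 = ζ * cauchyTransform (fun z => F z / z) ζ := by
  have hR : ‖(0 : ℂ)‖ ≤ R := by simpa using (norm_nonneg ζ).trans hζ
  rw [cauchyTransform, cauchyTransform, cauchyTransform, ← integral_const_mul,
    ← integral_sub (cauchyTransform_bound hm hK hout hF hζ).1
      (cauchyTransform_bound hm hK hout hF hR).1]
  refine integral_congr_ae ?_
  have h0 : ∀ᵐ z : ℂ, z ≠ 0 := by simp [ae_iff]
  have h1 : ∀ᵐ z : ℂ, z ≠ ζ := by simp [ae_iff]
  filter_upwards [h0, h1] with z hz0 hz1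
  have := sub_ne_zero.2 hz1
  simp only [sub_zero]
  field_simp
  ring

/-- The Cauchy transform of a bounded function is Hölder continuous at the origin. -/
lemma norm_cauchyTransform_sub_le_sqrt (hm : AEStronglyMeasurable F) (hK : 0 ≤ K)
    (hout : ∀ z, R ≤ ‖z‖ → F z = 0) (hF : ∀ z, ‖F z‖ ≤ K) {ζ : ℂ} (hζ : ‖ζ‖ ≤ R) :
    ‖cauchyTransform F ζ - cauchyTransform F 0‖ ≤ 2 * K * √‖ζ‖ * (2 * kernelMass R) := by
  rw [cauchyTransform_sub hm hK hout hF hζ, cauchyTransform, ← integral_const_mul]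
  refine (integrable_of_le_radialKernel ((((hm.mul
    measurable_inv.aestronglyMeasurable).mul
    (by fun_prop : Measurable fun z : ℂ => (z - ζ)⁻¹).aestronglyMeasurable)).const_mul ζ)
    (by positivity) hζ (fun z hz => by simp [hout z hz]) fun z hz0 hz1 hzR => ?_).2
  have ha : 0 < ‖z‖ := norm_pos_iff.2 hz0
  have hb : 0 < ‖z - ζ‖ := norm_pos_iff.2 (sub_ne_zero.2 hz1)
  have ht : ‖ζ‖ ≤ ‖z‖ + ‖z - ζ‖ := by
    have := norm_sub_le z (z - ζ); rwa [sub_sub_cancel] at this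
  have hα := Real.sqrt_pos.2 ha
  have hβ := Real.sqrt_pos.2 hb
  have hτ := Real.sqrt_nonneg ‖ζ‖
  have key : ‖ζ‖ * (‖z‖⁻¹ * ‖z - ζ‖⁻¹) ≤
      2 * √‖ζ‖ * (radialKernel z + radialKernel (z - ζ)) := by
    rw [radialKernel, radialKernel]
    nth_rewrite 1 [← Real.sq_sqrt ha.le, ← Real.sq_sqrt hb.le, ← Real.sq_sqrt (norm_nonneg ζ)]
    have ht' : √‖ζ‖ ^ 2 ≤ √‖z‖ ^ 2 + √‖z - ζ‖ ^ 2 := by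
      rwa [Real.sq_sqrt ha.le, Real.sq_sqrt hb.le, Real.sq_sqrt (norm_nonneg ζ)]
    generalize √‖z‖ = α at *
    generalize √‖z - ζ‖ = β at *
    generalize √‖ζ‖ = τ at *
    have h1 : τ ≤ α + β := abs_le_of_sq_le_sq' (by nlinarith [mul_pos hα hβ]) (by positivity) |>.2
    have h2 : (α + β) * (α * β) ≤ 2 * (α ^ 3 + β ^ 3) := by
      have : α ^ 3 + β ^ 3 - (α + β) * (α * β) = (α + β) * (α - β) ^ 2 := by ring
      have h3 : 0 ≤ (α + β) * (α - β) ^ 2 := by positivity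
      have h4 : 0 ≤ α ^ 3 + β ^ 3 := by positivity
      linarith
    have h3 : τ * (α * β) ≤ 2 * (α ^ 3 + β ^ 3) := (by gcongr : _ ≤ (α + β) * (α * β)).trans h2
    have e1 : τ ^ 2 * ((α ^ 2)⁻¹ * (β ^ 2)⁻¹) = (τ * (τ * (α * β))) / (α ^ 3 * β ^ 3) := by
      field_simp
    have e2 : 2 * τ * ((α ^ 3)⁻¹ + (β ^ 3)⁻¹) = (τ * (2 * (α ^ 3 + β ^ 3))) / (α ^ 3 * β ^ 3) := by
      field_simp; ring
    rw [e1, e2]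
    gcongr
  simp only [Pi.mul_apply, norm_mul, norm_inv]
  calc ‖ζ‖ * (‖F z‖ * ‖z‖⁻¹ * ‖z - ζ‖⁻¹) = ‖F z‖ * (‖ζ‖ * (‖z‖⁻¹ * ‖z - ζ‖⁻¹)) := by ring
    _ ≤ K * (2 * √‖ζ‖ * (radialKernel z + radialKernel (z - ζ))) := by
        gcongr; exact hF z
    _ = _ := by ring

/-- If the density is `O(|z|^(1/2))`, its Cauchy transform is Lipschitz at the origin. -/
lemma norm_cauchyTransform_sub_le (hm : AEStronglyMeasurable F) (hK : 0 ≤ K)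
    (hout : ∀ z, R ≤ ‖z‖ → F z = 0) (hF : ∀ z, ‖F z‖ ≤ K * √‖z‖) {ζ : ℂ} (hζ : ‖ζ‖ ≤ R) :
    ‖cauchyTransform F ζ - cauchyTransform F 0‖ ≤ K * ‖ζ‖ * (2 * kernelMass R) := by
  have hF' : ∀ z, ‖F z‖ ≤ K * √R := fun z => by
    rcases le_or_gt R ‖z‖ with h | h
    · rw [hout z h, norm_zero]; positivity
    · exact (hF z).trans (by gcongr)
  rw [cauchyTransform_sub hm (by positivity) hout hF' hζ, cauchyTransform, ← integral_const_mul]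
  refine (integrable_of_le_radialKernel ((((hm.mul
    measurable_inv.aestronglyMeasurable).mul
    (by fun_prop : Measurable fun z : ℂ => (z - ζ)⁻¹).aestronglyMeasurable)).const_mul ζ)
    (by positivity) hζ (fun z hz => by simp [hout z hz]) fun z hz0 hz1 hzR => ?_).2
  have ha : 0 < ‖z‖ := norm_pos_iff.2 hz0
  have hb : 0 < ‖z - ζ‖ := norm_pos_iff.2 (sub_ne_zero.2 hz1)
  have hα := Real.sqrt_pos.2 ha
  have hβ := Real.sqrt_pos.2 hb
  have key : √‖z‖ * (‖z‖⁻¹ * ‖z - ζ‖⁻¹) ≤ radialKernel z + radialKernel (z - ζ) := by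
    rw [radialKernel, radialKernel]
    nth_rewrite 2 [← Real.sq_sqrt ha.le]
    nth_rewrite 1 [← Real.sq_sqrt hb.le]
    generalize √‖z‖ = α at *
    generalize √‖z - ζ‖ = β at *
    have h2 : α ^ 2 * β ≤ α ^ 3 + β ^ 3 := by
      rcases le_total α β with h | h
      · have : α ^ 2 * β ≤ β ^ 2 * β := by gcongr
        nlinarith [pow_pos hα 3]
      · have : α ^ 2 * β ≤ α ^ 2 * α := by gcongr
        nlinarith [pow_pos hβ 3]
    have e1 : α * ((α ^ 2)⁻¹ * (β ^ 2)⁻¹) = (α ^ 2 * β) / (α ^ 3 * β ^ 3) := by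
      field_simp
    have e2 : (α ^ 3)⁻¹ + (β ^ 3)⁻¹ = (α ^ 3 + β ^ 3) / (α ^ 3 * β ^ 3) := by
      field_simp; ring
    rw [e1, e2]
    gcongr
  simp only [Pi.mul_apply, norm_mul, norm_inv]
  calc ‖ζ‖ * (‖F z‖ * ‖z‖⁻¹ * ‖z - ζ‖⁻¹) ≤ ‖ζ‖ * (K * √‖z‖ * ‖z‖⁻¹ * ‖z - ζ‖⁻¹) := by
        gcongr; exact hF z
    _ = K * ‖ζ‖ * (√‖z‖ * (‖z‖⁻¹ * ‖z - ζ‖⁻¹)) := by ring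
    _ ≤ _ := by gcongr

end CauchyTransform

/-! ### Expansion of solutions of the inhomogeneous Cauchy–Riemann equation -/

lemma dbarTwo_congr {f g : ℂ → ℂ} {z : ℂ} (h : f =ᶠ[𝓝 z] g) : dbarTwo f z = dbarTwo g z := by
  simp only [dbarTwo, h.fderiv_eq]

lemma exists_support_radius {h : ℂ → ℂ} (hc : HasCompactSupport h) :
    ∃ R : ℝ, 0 < R ∧ ∀ z, R ≤ ‖z‖ → h z = 0 ∧ dbarTwo h z = 0 := by
  obtain ⟨R, hR⟩ := hc.isBounded.subset_ball (0 : ℂ)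
  refine ⟨max R 1, by positivity, fun z hz => ?_⟩
  have hz' : z ∉ tsupport h := fun hz' => by
    have := hR hz'
    rw [mem_ball_zero_iff] at this
    exact absurd (le_max_left R 1) (by linarith)
  refine ⟨image_eq_zero_of_notMem_tsupport hz', ?_⟩
  have : fderiv ℝ h z = 0 :=
    image_eq_zero_of_notMem_tsupport fun h' => hz' (tsupport_fderiv_subset ℝ h')
  simp [dbarTwo, this]

/-- A bounded function satisfying a power bound at the origin satisfies it everywhere. -/
lemma exists_global_bound {f : ℂ → ℂ} {g : ℂ → ℝ} (hg : ∀ z, 0 ≤ g z)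
    (hmono : ∀ z z', ‖z‖ ≤ ‖z'‖ → g z ≤ g z') (hpos : ∀ z, z ≠ 0 → 0 < g z)
    {M : ℝ} (hf : ∀ z, ‖f z‖ ≤ M) (ho : f =O[𝓝 0] g) : ∃ K, 0 ≤ K ∧ ∀ z, ‖f z‖ ≤ K * g z := by
  obtain ⟨c, hc, hc'⟩ := ho.exists_nonneg
  obtain ⟨δ, hδ, hb⟩ := Metric.eventually_nhds_iff_ball.1 hc'.bound
  have hM : 0 ≤ M := (norm_nonneg _).trans (hf 0)
  have hδ' : ‖((δ / 2 : ℝ) : ℂ)‖ = δ / 2 := by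
    rw [Complex.norm_real, Real.norm_of_nonneg (by positivity)]
  have hgδ : 0 < g (δ / 2 : ℝ) := hpos _ (by exact_mod_cast (half_pos hδ).ne')
  refine ⟨c + M / g (δ / 2 : ℝ), by positivity, fun z => ?_⟩
  have := hg z
  rcases lt_or_ge ‖z‖ δ with hz | hz
  · have := hb z (by simpa using hz)
    rw [Real.norm_of_nonneg (hg z)] at this
    exact this.trans (mul_le_mul_of_nonneg_right (le_add_of_nonneg_right (by positivity)) (hg z))
  · have h1 : g (δ / 2 : ℝ) ≤ g z := hmono _ _ (by rw [hδ']; linarith)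
    calc ‖f z‖ ≤ M := hf z
      _ = M / g (δ / 2 : ℝ) * g (δ / 2 : ℝ) := by field_simp
      _ ≤ (c + M / g (δ / 2 : ℝ)) * g z := by gcongr; linarith

lemma exists_global_pow_bound {f : ℂ → ℂ} {M : ℝ} (hf : ∀ z, ‖f z‖ ≤ M) {k : ℕ}
    (ho : f =O[𝓝 0] fun z => ‖z‖ ^ k) : ∃ K, 0 ≤ K ∧ ∀ z, ‖f z‖ ≤ K * ‖z‖ ^ k :=
  exists_global_bound (fun z => by positivity) (fun z z' h => by gcongr)
    (fun z hz => by have := norm_pos_iff.2 hz; positivity) hf ho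

lemma norm_dbarTwo_div_pow_le {h : ℂ → ℂ} {k : ℕ} {K : ℝ} (hK : 0 ≤ K)
    (hf : ∀ z, ‖dbarTwo h z‖ ≤ K * ‖z‖ ^ k) (z : ℂ) : ‖dbarTwo h z / z ^ k‖ ≤ K := by
  rw [norm_div, norm_pow]
  exact div_le_of_le_mul₀ (by positivity) hK (hf z)

section Expansion

variable {h : ℂ → ℂ}

lemma aestronglyMeasurable_dbarTwo_div_pow (hh : ContDiff ℝ 1 h) (k : ℕ) :
    AEStronglyMeasurable (fun z => dbarTwo h z / z ^ k) :=
  ((continuous_dbarTwo hh).measurable.div (by fun_prop)).aestronglyMeasurable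

lemma tendsto_cauchyTransform {F : ℂ → ℂ} {R K : ℝ} (hR : 0 < R) (hm : AEStronglyMeasurable F)
    (hK : 0 ≤ K) (hout : ∀ z, R ≤ ‖z‖ → F z = 0) (hF : ∀ z, ‖F z‖ ≤ K) :
    Tendsto (cauchyTransform F) (𝓝 0) (𝓝 (cauchyTransform F 0)) := by
  rw [tendsto_iff_norm_sub_tendsto_zero]
  have h0 : Tendsto (fun ζ : ℂ => 2 * K * √‖ζ‖ * (2 * kernelMass R)) (𝓝 0) (𝓝 0) := by
    have : Continuous (fun ζ : ℂ => 2 * K * √‖ζ‖ * (2 * kernelMass R)) := by fun_prop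
    simpa using this.tendsto 0
  refine squeeze_zero' (Eventually.of_forall fun _ => norm_nonneg _) ?_ h0
  filter_upwards [Metric.ball_mem_nhds (0 : ℂ) hR] with ζ hζ
  exact norm_cauchyTransform_sub_le_sqrt hm hK hout hF (by simpa using (mem_ball_zero_iff.1 hζ).le)

/-- If `h` and `∂h/∂z̄` vanish to order `k` at the origin, the quotient `h / z ^ k` is still
represented by the Cauchy–Pompeiu formula: the first `k` moments of `∂h/∂z̄` vanish. -/
lemma pow_mul_cauchyTransform (hh : ContDiff ℝ 1 h) (hc : HasCompactSupport h) (k : ℕ)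
    (hf : ∃ K, 0 ≤ K ∧ ∀ z, ‖dbarTwo h z‖ ≤ K * ‖z‖ ^ k) (ho : h =O[𝓝 0] fun z => ‖z‖ ^ k)
    (ζ : ℂ) :
    ζ ^ k * cauchyTransform (fun z => dbarTwo h z / z ^ k) ζ = -(2 * Real.pi) * h ζ := by
  obtain ⟨R, hR, hout⟩ := exists_support_radius hc
  induction k generalizing ζ with
  | zero => simpa [cauchyTransform] using integral_dbarTwo_div_sub hh hc ζ
  | succ k ih =>
    obtain ⟨K, hK, hf⟩ := hf
    have hf' : ∀ z, ‖dbarTwo h z‖ ≤ (K * R) * ‖z‖ ^ k := fun z => by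
      rcases le_or_gt R ‖z‖ with hz | hz
      · rw [(hout z hz).2, norm_zero]; positivity
      · calc ‖dbarTwo h z‖ ≤ K * ‖z‖ ^ (k + 1) := hf z
          _ = K * ‖z‖ * ‖z‖ ^ k := by ring
          _ ≤ _ := by gcongr
    have ho' : h =O[𝓝 0] fun z => ‖z‖ ^ k := by
      refine ho.trans (IsBigO.of_bound 1 ?_)
      filter_upwards [Metric.ball_mem_nhds (0 : ℂ) one_pos] with z hz
      have hz : ‖z‖ < 1 := by simpa using hz
      rw [one_mul, Real.norm_of_nonneg (by positivity), Real.norm_of_nonneg (by positivity)]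
      exact pow_le_pow_of_le_one (norm_nonneg z) hz.le (Nat.le_succ k)
    have ih := ih ⟨K * R, by positivity, hf'⟩ ho'
    set F : ℂ → ℂ := fun z => dbarTwo h z / z ^ k with hFdef
    have hm := aestronglyMeasurable_dbarTwo_div_pow hh k
    have hFK := norm_dbarTwo_div_pow_le (by positivity) hf'
    have hFout : ∀ R', R ≤ R' → ∀ z, R' ≤ ‖z‖ → F z = 0 := fun R' hR' z hz => by
      simp only [hFdef, (hout z (hR'.trans hz)).2, zero_div]
    have hG0 : cauchyTransform F 0 = 0 := by
      have t1 : Tendsto (cauchyTransform F) (𝓝[≠] 0) (𝓝 (cauchyTransform F 0)) :=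
        (tendsto_cauchyTransform hR hm (by positivity) (hFout R le_rfl) hFK).mono_left
          nhdsWithin_le_nhds
      have t2 : Tendsto (cauchyTransform F) (𝓝[≠] 0) (𝓝 0) := by
        obtain ⟨c, hc0, hc⟩ := ho.exists_nonneg
        rw [tendsto_zero_iff_norm_tendsto_zero]
        have h0 : Tendsto (fun ζ : ℂ => 2 * Real.pi * (c * ‖ζ‖)) (𝓝[≠] 0) (𝓝 0) := by
          have : Continuous (fun ζ : ℂ => 2 * Real.pi * (c * ‖ζ‖)) := by fun_prop
          simpa using (this.tendsto 0).mono_left nhdsWithin_le_nhds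
        refine squeeze_zero' (Eventually.of_forall fun _ => norm_nonneg _) ?_ h0
        filter_upwards [hc.bound.filter_mono nhdsWithin_le_nhds, self_mem_nhdsWithin] with ξ h1 h2
        have hξ : 0 < ‖ξ‖ ^ k := by have := norm_pos_iff.2 h2; positivity
        rw [Real.norm_of_nonneg (by positivity)] at h1
        have h3 := congrArg norm (ih ξ)
        rw [norm_mul, norm_mul, norm_pow, norm_neg] at h3
        have h4 : ‖(2 * Real.pi : ℂ)‖ = 2 * Real.pi := by
          simp [abs_of_pos Real.pi_pos]
        rw [h4] at h3
        refine le_of_mul_le_mul_left ?_ hξ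
        rw [h3]
        calc 2 * Real.pi * ‖h ξ‖ ≤ 2 * Real.pi * (c * ‖ξ‖ ^ (k + 1)) := by
              have := Real.pi_pos; gcongr
          _ = _ := by ring
      exact tendsto_nhds_unique t1 t2
    have h5 := cauchyTransform_sub (R := max R ‖ζ‖) hm (by positivity)
      (hFout _ (le_max_left _ _)) hFK (le_max_right _ _)
    rw [hG0, sub_zero] at h5
    rw [← ih ζ, h5]
    simp only [div_div, pow_succ, mul_assoc]

lemma expansion_eq (hh : ContDiff ℝ 1 h) (hc : HasCompactSupport h) (k : ℕ)
    (hf : ∃ K, 0 ≤ K ∧ ∀ z, ‖dbarTwo h z‖ ≤ K * ‖z‖ ^ k) (ho : h =O[𝓝 0] fun z => ‖z‖ ^ k)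
    (ζ : ℂ) :
    h ζ - (-(2 * Real.pi) : ℂ)⁻¹ * cauchyTransform (fun z => dbarTwo h z / z ^ k) 0 * ζ ^ k =
      (-(2 * Real.pi) : ℂ)⁻¹ * ζ ^ k * (cauchyTransform (fun z => dbarTwo h z / z ^ k) ζ -
        cauchyTransform (fun z => dbarTwo h z / z ^ k) 0) := by
  have hpi : (-(2 * Real.pi) : ℂ) ≠ 0 := by simp [Real.pi_ne_zero]
  have h1 : h ζ = (-(2 * Real.pi) : ℂ)⁻¹ * (-(2 * Real.pi) * h ζ) := by
    rw [← mul_assoc, inv_mul_cancel₀ hpi, one_mul]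
  rw [h1, ← pow_mul_cauchyTransform hh hc k hf ho ζ]
  ring

lemma exists_leading_coeff (hh : ContDiff ℝ 1 h) (hc : HasCompactSupport h) (k : ℕ)
    (hf : ∃ K, 0 ≤ K ∧ ∀ z, ‖dbarTwo h z‖ ≤ K * ‖z‖ ^ k) (ho : h =O[𝓝 0] fun z => ‖z‖ ^ k) :
    ∃ a : ℂ, (fun z => h z - a * z ^ k) =O[𝓝 0] fun z => ‖z‖ ^ k * √‖z‖ := by
  obtain ⟨R, hR, hout⟩ := exists_support_radius hc
  obtain ⟨K, hK, hf'⟩ := hf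
  refine ⟨(-(2 * Real.pi) : ℂ)⁻¹ * cauchyTransform (fun z => dbarTwo h z / z ^ k) 0,
    IsBigO.of_bound (‖(-(2 * Real.pi) : ℂ)⁻¹‖ * (2 * K * (2 * kernelMass R))) ?_⟩
  filter_upwards [Metric.ball_mem_nhds (0 : ℂ) hR] with ζ hζ
  rw [expansion_eq hh hc k ⟨K, hK, hf'⟩ ho ζ, norm_mul, norm_mul, norm_pow,
    Real.norm_of_nonneg (by positivity)]
  have := norm_cauchyTransform_sub_le_sqrt (aestronglyMeasurable_dbarTwo_div_pow hh k) hK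
    (fun z hz => by simp only [(hout z hz).2, zero_div]) (norm_dbarTwo_div_pow_le hK hf')
    (mem_ball_zero_iff.1 hζ).le
  calc _ ≤ ‖(-(2 * Real.pi) : ℂ)⁻¹‖ * ‖ζ‖ ^ k * (2 * K * √‖ζ‖ * (2 * kernelMass R)) := by gcongr
    _ = _ := by ring

lemma exists_leading_coeff_of_sqrt (hh : ContDiff ℝ 1 h) (hc : HasCompactSupport h) (k : ℕ)
    (hf : ∃ K, 0 ≤ K ∧ ∀ z, ‖dbarTwo h z‖ ≤ K * (‖z‖ ^ k * √‖z‖))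
    (ho : h =O[𝓝 0] fun z => ‖z‖ ^ k) :
    ∃ a : ℂ, (fun z => h z - a * z ^ k) =O[𝓝 0] fun z => ‖z‖ ^ (k + 1) := by
  obtain ⟨R, hR, hout⟩ := exists_support_radius hc
  obtain ⟨K, hK, hf'⟩ := hf
  have hf2 : ∀ z, ‖dbarTwo h z‖ ≤ (K * √R) * ‖z‖ ^ k := fun z => by
    rcases le_or_gt R ‖z‖ with hz | hz
    · rw [(hout z hz).2, norm_zero]; positivity
    · calc ‖dbarTwo h z‖ ≤ K * (‖z‖ ^ k * √‖z‖) := hf' z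
        _ ≤ K * (‖z‖ ^ k * √R) := by gcongr
        _ = _ := by ring
  refine ⟨(-(2 * Real.pi) : ℂ)⁻¹ * cauchyTransform (fun z => dbarTwo h z / z ^ k) 0,
    IsBigO.of_bound (‖(-(2 * Real.pi) : ℂ)⁻¹‖ * (K * (2 * kernelMass R))) ?_⟩
  filter_upwards [Metric.ball_mem_nhds (0 : ℂ) hR] with ζ hζ
  rw [expansion_eq hh hc k ⟨_, by positivity, hf2⟩ ho ζ, norm_mul, norm_mul, norm_pow,
    Real.norm_of_nonneg (by positivity)]
  have := norm_cauchyTransform_sub_le (aestronglyMeasurable_dbarTwo_div_pow hh k) hK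
    (fun z hz => by simp only [(hout z hz).2, zero_div])
    (fun z => by
      rw [norm_div, norm_pow]
      exact div_le_of_le_mul₀ (by positivity) (by positivity)
        ((hf' z).trans_eq (by ring)))
    (mem_ball_zero_iff.1 hζ).le
  calc _ ≤ ‖(-(2 * Real.pi) : ℂ)⁻¹‖ * ‖ζ‖ ^ k * (K * ‖ζ‖ * (2 * kernelMass R)) := by gcongr
    _ = _ := by ring

end Expansion

/-- A `C¹` germ extends to a compactly supported `C¹` function on `ℂ`. -/
lemma exists_cutoff {w : ℂ → ℂ} {ρ R : ℝ} (hw : ∀ z ∈ Metric.ball (0 : ℂ) ρ, ContDiffAt ℝ 1 w z)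
    (hR : 0 < R) (hRρ : R < ρ) :
    ∃ h : ℂ → ℂ, ContDiff ℝ 1 h ∧ HasCompactSupport h ∧ (∀ z, ‖z‖ < R / 2 → h z = w z) ∧
      ∀ z, R ≤ ‖z‖ → h z = 0 ∧ dbarTwo h z = 0 := by
  let χ : ContDiffBump (0 : ℂ) := ⟨R / 2, R, by positivity, by linarith⟩
  have hts : tsupport (fun z => (χ z : ℂ) * w z) ⊆ Metric.closedBall 0 R := by
    have h1 : tsupport χ = Metric.closedBall 0 R := χ.tsupport_eq
    rw [← h1]
    refine closure_mono fun z hz => ?_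
    simp only [Function.mem_support] at hz ⊢
    intro h0; simp [h0] at hz
  have hsm : ContDiff ℝ 1 (fun z => (χ z : ℂ) * w z) := by
    refine contMDiff_iff_contDiff.1 (contMDiff_of_tsupport fun z hz => ContDiffAt.contMDiffAt ?_)
    have hzρ : z ∈ Metric.ball (0 : ℂ) ρ := Metric.closedBall_subset_ball hRρ (hts hz)
    have h1 : ContDiffAt ℝ 1 (fun z => (χ z : ℂ)) z :=
      (Complex.ofRealCLM.contDiff.comp χ.contDiff).contDiffAt
    exact h1.mul (hw z hzρ)
  refine ⟨_, hsm, ?_, fun z hz => ?_, fun z hz => ?_⟩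
  · exact (isCompact_closedBall (0 : ℂ) R).of_isClosed_subset (isClosed_tsupport _) hts
  · rw [χ.one_of_mem_closedBall (by simpa using hz.le)]; simp
  · have h0 : ∀ y, R ≤ ‖y‖ → (χ y : ℂ) * w y = 0 := fun y hy => by
      rw [χ.zero_of_le_dist (by simpa using hy)]; simp
    refine ⟨h0 z hz, ?_⟩
    -- the continuous function `dbarTwo h` vanishes off the closed ball, hence on its frontier
    have h1 : closure (Metric.closedBall (0 : ℂ) R)ᶜ ⊆
        {y | dbarTwo (fun z => (χ z : ℂ) * w z) y = 0} := by
      refine closure_minimal (fun y hy => ?_)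
        (isClosed_eq (continuous_dbarTwo hsm) continuous_const)
      have : (fun z => (χ z : ℂ) * w z) =ᶠ[𝓝 y] fun _ => 0 := by
        filter_upwards [Metric.isClosed_closedBall.isOpen_compl.mem_nhds hy] with x hx
        exact h0 x (by simpa using (not_le.1 (by simpa using hx)).le)
      show dbarTwo _ y = 0
      rw [dbarTwo_congr this]
      simp [dbarTwo]
    refine h1 ?_
    rw [closure_compl, interior_closedBall _ hR.ne']
    simpa using hz

lemma exists_bound_dbarTwo {h : ℂ → ℂ} (hh : ContDiff ℝ 1 h) (hc : HasCompactSupport h) :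
    ∃ K, 0 ≤ K ∧ ∀ z, ‖dbarTwo h z‖ ≤ K := by
  obtain ⟨R, hR, hout⟩ := exists_support_radius hc
  have : HasCompactSupport (dbarTwo h) :=
    HasCompactSupport.of_support_subset_isCompact (isCompact_closedBall (0 : ℂ) R) fun z hz => by
      by_contra hz'
      exact hz (hout z (by simpa using (not_le.1 (by simpa using hz')).le)).2
  obtain ⟨K, hK⟩ := this.exists_bound_of_continuous (continuous_dbarTwo hh)
  exact ⟨K, (norm_nonneg _).trans (hK 0), hK⟩

/-! ### Unique continuation and leading monomials -/

lemma ContDiffAt.exists_ball {w : ℂ → ℂ} (hw : ContDiffAt ℝ 1 w 0) :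
    ∃ ρ > 0, ∀ z ∈ Metric.ball (0 : ℂ) ρ, ContDiffAt ℝ 1 w z :=
  Metric.eventually_nhds_iff_ball.1 (hw.eventually (by decide))

/-- Strong unique continuation: a solution of `|∂w/∂z̄| ≤ C |w|` which vanishes to infinite order
at a point vanishes near that point. The supremum of `|h| / |z| ^ k`, for a cut-off `h` of `w`, is
controlled by its own half and by the contribution of the region where the cut-off is not
constant, which is only `O((2 / R) ^ k)`. -/
lemma eventually_eq_zero_of_infinite_order {w : ℂ → ℂ} (hw : ContDiffAt ℝ 1 w 0) {C : ℝ}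
    (hC : 0 ≤ C) (hb : ∀ᶠ z in 𝓝 0, ‖dbarTwo w z‖ ≤ C * ‖w z‖)
    (ho : ∀ k : ℕ, w =O[𝓝 0] fun z => ‖z‖ ^ k) : ∀ᶠ z in 𝓝 0, w z = 0 := by
  obtain ⟨ρ₁, hρ₁, hw⟩ := hw.exists_ball
  obtain ⟨ρ₂, hρ₂, hb⟩ := Metric.eventually_nhds_iff_ball.1 hb
  -- a radius for which the Cauchy transform is a contraction
  obtain ⟨R, hR, hR₁, hR₂, hRc⟩ : ∃ R > 0, R < ρ₁ ∧ R < ρ₂ ∧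
      (C + 1) * (√(2 * R) * (2 * kernelMass R)) ≤ 1 / 2 := by
    have h0 : Tendsto (fun R : ℝ => (C + 1) * (√(2 * R) * (2 * kernelMass 1))) (𝓝[>] 0) (𝓝 0) := by
      have : Continuous (fun R : ℝ => (C + 1) * (√(2 * R) * (2 * kernelMass 1))) := by fun_prop
      simpa using (this.tendsto 0).mono_left nhdsWithin_le_nhds
    have h1 : ∀ᶠ R : ℝ in 𝓝[>] 0, R < min (min ρ₁ ρ₂) 1 :=
      nhdsWithin_le_nhds (Iio_mem_nhds (by positivity))
    obtain ⟨R, ⟨h2, h3⟩, h4⟩ :=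
      (((h0.eventually (Iic_mem_nhds (by norm_num : (0 : ℝ) < 1 / 2))).and h1).and
        self_mem_nhdsWithin).exists
    have h3' := lt_min_iff.1 h3
    have h3'' := lt_min_iff.1 h3'.1
    refine ⟨R, h4, h3''.1, h3''.2, le_trans ?_ h2⟩
    have := kernelMass_mono h3'.2.le
    gcongr
  obtain ⟨h, hh, hc, hin, hout⟩ := exists_cutoff hw hR hR₁
  obtain ⟨K, hK, hbd⟩ := exists_bound_dbarTwo hh hc
  obtain ⟨M, hM⟩ := hc.exists_bound_of_continuous hh.continuous
  have hR2 : 0 < R / 2 := by positivity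
  have hev : h =ᶠ[𝓝 0] w := by
    filter_upwards [Metric.ball_mem_nhds (0 : ℂ) hR2] with z hz
    exact hin z (by simpa using hz)
  have hd : ∀ z, ‖z‖ < R / 2 → ‖dbarTwo h z‖ ≤ C * ‖h z‖ := fun z hz => by
    have h1 : h =ᶠ[𝓝 z] w := by
      filter_upwards [Metric.isOpen_ball.mem_nhds (mem_ball_zero_iff.2 hz)] with y hy
      exact hin y (by simpa using hy)
    rw [dbarTwo_congr h1, hin z hz]
    exact hb z (by rw [mem_ball_zero_iff]; linarith)
  set c := √(2 * R) * (2 * kernelMass R) with hcdef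
  have hc0 : 0 ≤ c := by have := kernelMass_nonneg R; positivity
  have key : ∀ (k : ℕ) (z : ℂ), ‖h z‖ ≤ 2 * (K * (2 / R) ^ k) * ‖z‖ ^ k := fun k => by
    have hok : h =O[𝓝 0] fun z => ‖z‖ ^ k := (ho k).congr' hev.symm EventuallyEq.rfl
    obtain ⟨B₀, hB₀, hhB₀⟩ := exists_global_pow_bound hM hok
    have hbdd : BddAbove (range fun z => ‖h z‖ / ‖z‖ ^ k) := by
      refine ⟨B₀, ?_⟩
      rintro _ ⟨z, rfl⟩
      exact div_le_of_le_mul₀ (by positivity) hB₀ (hhB₀ z)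
    set B := ⨆ z, ‖h z‖ / ‖z‖ ^ k
    have hB : 0 ≤ B := (by positivity : 0 ≤ ‖h 0‖ / ‖(0 : ℂ)‖ ^ k).trans (le_ciSup hbdd 0)
    have hhB : ∀ z, ‖h z‖ ≤ B * ‖z‖ ^ k := fun z => by
      rcases (by positivity : 0 ≤ ‖z‖ ^ k).eq_or_lt with h0 | h0
      · have := hhB₀ z
        rw [← h0, mul_zero] at this ⊢
        exact this
      · exact (div_le_iff₀ h0).1 (le_ciSup hbdd z)
    set L := C * B + K * (2 / R) ^ k
    have hL : 0 ≤ L := by positivity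
    have hfL : ∀ z, ‖dbarTwo h z‖ ≤ L * ‖z‖ ^ k := fun z => by
      rcases lt_or_ge ‖z‖ (R / 2) with hz | hz
      · calc ‖dbarTwo h z‖ ≤ C * ‖h z‖ := hd z hz
          _ ≤ C * (B * ‖z‖ ^ k) := by gcongr; exact hhB z
          _ = C * B * ‖z‖ ^ k := by ring
          _ ≤ L * ‖z‖ ^ k := by
            gcongr
            simp only [L]
            linarith [(by positivity : 0 ≤ K * (2 / R) ^ k)]
      · calc ‖dbarTwo h z‖ ≤ K * 1 := by rw [mul_one]; exact hbd z
          _ ≤ K * ((2 / R) * ‖z‖) ^ k := by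
              gcongr
              refine one_le_pow₀ ?_
              rw [div_mul_eq_mul_div, le_div_iff₀ hR]; linarith
          _ = K * (2 / R) ^ k * ‖z‖ ^ k := by rw [mul_pow]; ring
          _ ≤ L * ‖z‖ ^ k := by gcongr; simp only [L]; linarith [(by positivity : 0 ≤ C * B)]
    have hstep : ∀ z, ‖h z‖ ≤ L * c * ‖z‖ ^ k := fun z => by
      rcases le_or_gt R ‖z‖ with hz | hz
      · rw [(hout z hz).1, norm_zero]; positivity
      · have h1 := (cauchyTransform_bound (aestronglyMeasurable_dbarTwo_div_pow hh k) hL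
          (fun z hz => by simp only [(hout z hz).2, zero_div])
          (norm_dbarTwo_div_pow_le hL hfL) hz.le).2
        have h2 := congrArg norm (pow_mul_cauchyTransform hh hc k ⟨L, hL, hfL⟩ hok z)
        have h4 : ‖(2 * Real.pi : ℂ)‖ = 2 * Real.pi := by simp [abs_of_pos Real.pi_pos]
        rw [norm_mul, norm_mul, norm_pow, norm_neg, h4] at h2
        calc ‖h z‖ ≤ 2 * Real.pi * ‖h z‖ :=
              le_mul_of_one_le_left (norm_nonneg _) (by linarith [Real.pi_gt_three])
          _ ≤ ‖z‖ ^ k * (L * √(2 * R) * (2 * kernelMass R)) := by rw [← h2]; gcongr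
          _ = _ := by rw [hcdef]; ring
    have hBle : B ≤ L * c :=
      ciSup_le fun z => div_le_of_le_mul₀ (by positivity) (by positivity) (hstep z)
    have h5 : L * c ≤ B / 2 + K * (2 / R) ^ k := by
      have h6 : C * c ≤ 1 / 2 := by linarith
      have h7 : c ≤ 1 := by nlinarith
      have h8 : B * (C * c) ≤ B * (1 / 2) := by gcongr
      have h9 : K * (2 / R) ^ k * c ≤ K * (2 / R) ^ k * 1 := by gcongr
      simp only [L]
      nlinarith
    intro z
    exact (hhB z).trans (by gcongr; linarith)
  filter_upwards [hev, Metric.ball_mem_nhds (0 : ℂ) hR2] with z hz hzR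
  rw [← hz, ← norm_le_zero_iff]
  have hz1 : 2 / R * ‖z‖ < 1 := by
    rw [mem_ball_zero_iff] at hzR
    rw [div_mul_eq_mul_div, div_lt_one hR]; linarith
  have ht : Tendsto (fun k : ℕ => 2 * K * (2 / R * ‖z‖) ^ k) atTop (𝓝 0) := by
    simpa using (tendsto_pow_atTop_nhds_zero_of_lt_one (by positivity) hz1).const_mul (2 * K)
  refine ge_of_tendsto' ht fun k => (key k z).trans_eq ?_
  rw [mul_pow]; ring

section Calculus

variable {f g : ℂ → ℂ} {z : ℂ}

lemma dbarTwo_mul (hf : DifferentiableAt ℝ f z) (hg : DifferentiableAt ℝ g z) :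
    dbarTwo (fun z => f z * g z) z = f z * dbarTwo g z + g z * dbarTwo f z := by
  simp only [dbarTwo]
  rw [fderiv_fun_mul hf hg]
  simp only [add_apply, smul_apply, smul_eq_mul]
  ring

lemma dbarTwo_pow (hf : DifferentiableAt ℝ f z) (n : ℕ) :
    dbarTwo (fun z => f z ^ (n + 1)) z = (n + 1) * f z ^ n * dbarTwo f z := by
  induction n with
  | zero => simp
  | succ n ih =>
    have : (fun z => f z ^ (n + 1 + 1)) = fun z => f z ^ (n + 1) * f z := by
      ext; rw [pow_succ]
    rw [this, dbarTwo_mul (hf.fun_pow _) hf, ih]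
    push_cast
    ring

lemma dbarTwo_add (hf : DifferentiableAt ℝ f z) (hg : DifferentiableAt ℝ g z) :
    dbarTwo (fun z => f z + g z) z = dbarTwo f z + dbarTwo g z := by
  simp only [dbarTwo]
  rw [fderiv_fun_add hf hg]
  simp only [add_apply]
  ring

lemma dbarTwo_sub (hf : DifferentiableAt ℝ f z) (hg : DifferentiableAt ℝ g z) :
    dbarTwo (fun z => f z - g z) z = dbarTwo f z - dbarTwo g z := by
  simp only [dbarTwo]
  rw [fderiv_fun_sub hf hg]
  simp only [sub_apply]
  ring

lemma dbarTwo_const (c : ℂ) : dbarTwo (fun _ => c) z = 0 := by simp [dbarTwo]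

lemma dbarTwo_id : dbarTwo (fun z => z) z = 0 := by simp [dbarTwo]

lemma dbarTwo_conj : dbarTwo (fun z => star z) z = 2 := by
  have : fderiv ℝ (fun z : ℂ => star z) z = Complex.conjCLE.toContinuousLinearMap :=
    Complex.conjCLE.toContinuousLinearMap.hasFDerivAt.fderiv
  simp only [dbarTwo, this]
  simp
  norm_num

end Calculus

/-- A particular solution of `2 ∂p/∂z̄ = A (a z ^ m)` vanishing to order `m + 1`. -/
lemma exists_particular_solution (A : ℂ →L[ℝ] ℂ) (a : ℂ) (m : ℕ) :
    ∃ p : ℂ → ℂ, ContDiff ℝ 1 p ∧ (∀ z, dbarTwo p z = A (a * z ^ m)) ∧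
      p =O[𝓝 0] fun z => ‖z‖ ^ (m + 1) := by
  -- the complex linear and the antilinear part of `A`
  obtain ⟨α, β, hA⟩ : ∃ α β : ℂ, ∀ c, A c = 2 * (α * c + β * star c) := by
    refine ⟨(A 1 - Complex.I * A Complex.I) / 4, (A 1 + Complex.I * A Complex.I) / 4, fun c => ?_⟩
    have h1 : A c = c.re * A 1 + c.im * A Complex.I := by
      conv_lhs => rw [show c = c.re • (1 : ℂ) + c.im • Complex.I by simp [Complex.re_add_im]]
      rw [map_add, map_smul, map_smul]; simp
    have h2 : star c = c.re - c.im * Complex.I := by apply Complex.ext <;> simp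
    rw [h1, h2]
    nth_rewrite 3 [← Complex.re_add_im c]
    ring_nf
    simp only [Complex.I_sq]
    ring
  have hconj : ContDiff ℝ 1 (fun z : ℂ => star z) := Complex.conjCLE.toContinuousLinearMap.contDiff
  have hid : ContDiff ℝ 1 (fun z : ℂ => z) := contDiff_id
  have hc1 : ContDiff ℝ 1 (fun z : ℂ => α * a * z ^ m) := contDiff_const.mul (hid.pow m)
  have hc2 : ContDiff ℝ 1 (fun z : ℂ => (star z) ^ (m + 1)) := hconj.pow _
  have hm : (m + 1 : ℂ) ≠ 0 := by exact_mod_cast m.succ_ne_zero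
  refine ⟨fun z => (α * a * z ^ m) * star z + (β * star a / (m + 1)) * (star z) ^ (m + 1),
    (hc1.mul hconj).add (contDiff_const.mul hc2), fun z => ?_, ?_⟩
  · have d1 := hc1.differentiable one_ne_zero z
    have d2 := hconj.differentiable one_ne_zero z
    have d3 := hc2.differentiable one_ne_zero z
    have d4 := (hid.pow m).differentiable one_ne_zero z
    have e1 : dbarTwo (fun z => z ^ m) z = 0 := by
      cases m with
      | zero => simp [dbarTwo]
      | succ m => rw [dbarTwo_pow (f := fun z => z) differentiableAt_fun_id, dbarTwo_id, mul_zero]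
    rw [dbarTwo_add (d1.fun_mul d2) ((differentiableAt_const _).fun_mul d3), dbarTwo_mul d1 d2,
      dbarTwo_mul (differentiableAt_const _) d3, dbarTwo_mul (differentiableAt_const _) d4,
      dbarTwo_const, dbarTwo_const, dbarTwo_pow d2, dbarTwo_conj, e1, hA, star_mul, star_pow]
    field_simp
    ring
  · refine IsBigO.of_bound (‖α * a‖ + ‖β * star a / (m + 1)‖) (Eventually.of_forall fun z => ?_)
    refine (norm_add_le _ _).trans ?_
    rw [norm_mul, norm_mul (α * a), norm_mul _ (star z ^ (m + 1)), norm_pow, norm_pow, norm_star,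
      Real.norm_of_nonneg (by positivity)]
    apply le_of_eq; ring

lemma pow_succ_isBigO_pow_mul_sqrt {m : ℕ} :
    (fun z : ℂ => ‖z‖ ^ (m + 1)) =O[𝓝 0] fun z => ‖z‖ ^ m * √‖z‖ := by
  refine IsBigO.of_bound 1 ?_
  filter_upwards [Metric.ball_mem_nhds (0 : ℂ) one_pos] with z hz
  have hz : ‖z‖ ≤ 1 := by simpa using (mem_ball_zero_iff.1 hz).le
  rw [one_mul, Real.norm_of_nonneg (by positivity), Real.norm_of_nonneg (by positivity), pow_succ]
  gcongr
  exact Real.le_sqrt_of_sq_le (by nlinarith [norm_nonneg z])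

/-- A `C¹` solution of `2 ∂w/∂z̄ = A w + O(|z| |w|)` with `w 0 = 0` either vanishes near the origin
or has a leading monomial, with an error of the next order. -/
theorem eventually_eq_zero_or_leading_monomial {w : ℂ → ℂ} (hw : ContDiffAt ℝ 1 w 0)
    (hw0 : w 0 = 0) (A : ℂ →L[ℝ] ℂ)
    (heq : (fun z => dbarTwo w z - A (w z)) =O[𝓝 0] fun z => ‖z‖ * ‖w z‖) :
    (∀ᶠ z in 𝓝 0, w z = 0) ∨ ∃ m : ℕ, 0 < m ∧ ∃ a : ℂ, a ≠ 0 ∧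
      (fun z => w z - a * z ^ m) =O[𝓝 0] fun z => ‖z‖ ^ (m + 1) := by
  obtain ⟨C, hC, hCb⟩ := heq.exists_nonneg
  by_cases hall : ∀ k : ℕ, w =O[𝓝 0] fun z => ‖z‖ ^ k
  · left
    refine eventually_eq_zero_of_infinite_order hw (C := ‖A‖ + C) (by positivity) ?_ hall
    filter_upwards [hCb.bound, Metric.ball_mem_nhds (0 : ℂ) one_pos] with z h1 hz
    have hz : ‖z‖ ≤ 1 := by simpa using (mem_ball_zero_iff.1 hz).le
    rw [Real.norm_of_nonneg (by positivity)] at h1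
    calc ‖dbarTwo w z‖ = ‖(dbarTwo w z - A (w z)) + A (w z)‖ := by rw [sub_add_cancel]
      _ ≤ C * (‖z‖ * ‖w z‖) + ‖A‖ * ‖w z‖ := (norm_add_le _ _).trans (add_le_add h1 (A.le_opNorm _))
      _ ≤ C * (1 * ‖w z‖) + ‖A‖ * ‖w z‖ := by gcongr
      _ = _ := by ring
  right
  push Not at hall
  classical
  obtain ⟨m, hm0, hm, hm'⟩ : ∃ m : ℕ, 0 < m ∧ w =O[𝓝 0] (fun z => ‖z‖ ^ m) ∧
      ¬ w =O[𝓝 0] fun z => ‖z‖ ^ (m + 1) := by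
    have h1 : w =O[𝓝 0] fun z => ‖z‖ ^ 1 := by
      have := (hw.differentiableAt one_ne_zero).isBigO_sub
      simpa [hw0] using this.norm_right
    have h0 : w =O[𝓝 0] fun z => ‖z‖ ^ 0 := by
      simpa using hw.continuousAt.isBigO_one ℝ
    have hfind := Nat.find_spec hall
    have hmin := fun j => Nat.find_min hall (m := j)
    generalize Nat.find hall = n at *
    match n, hfind, hmin with
    | 0, hf, _ => exact absurd h0 hf
    | 1, hf, _ => exact absurd h1 hf
    | m + 2, hf, hm => exact ⟨m + 1, m.succ_pos, not_not.1 (hm (m + 1) (by omega)), hf⟩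
  refine ⟨m, hm0, ?_⟩
  have hzw : (fun z => ‖z‖ * ‖w z‖) =O[𝓝 0] fun z => ‖z‖ ^ (m + 1) := by
    simpa [pow_succ'] using (isBigO_refl (fun z : ℂ => ‖z‖) (𝓝 0)).mul hm.norm_left
  have hpowle : (fun z : ℂ => ‖z‖ ^ m * √‖z‖) =O[𝓝 0] fun z => ‖z‖ ^ m := by
    have h1 : (fun z : ℂ => √‖z‖) =O[𝓝 0] fun _ => (1 : ℝ) :=
      (by fun_prop : Continuous fun z : ℂ => √‖z‖).continuousAt.isBigO_one ℝ
    simpa using (isBigO_refl (fun z : ℂ => ‖z‖ ^ m) (𝓝 0)).mul h1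
  have hAw : ∀ f : ℂ → ℂ, (fun z => A (f z)) =O[𝓝 0] f := fun f => A.isBigO_comp f _
  have hdw : dbarTwo w =O[𝓝 0] fun z => ‖z‖ ^ m := by
    have h1 : (fun z => dbarTwo w z - A (w z)) =O[𝓝 0] fun z => ‖z‖ ^ m :=
      (heq.trans hzw).trans (pow_succ_isBigO_pow_mul_sqrt.trans hpowle)
    simpa using h1.add ((hAw w).trans hm)
  obtain ⟨ρ, hρ, hwρ⟩ := hw.exists_ball
  have hcut : ∀ q : ℂ → ℂ, (∀ z ∈ Metric.ball (0 : ℂ) ρ, ContDiffAt ℝ 1 q z) → ∃ h : ℂ → ℂ,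
      ContDiff ℝ 1 h ∧ HasCompactSupport h ∧ h =ᶠ[𝓝 0] q ∧ dbarTwo h =ᶠ[𝓝 0] dbarTwo q :=
    fun q hq => by
      obtain ⟨h, h1, h2, h3, -⟩ := exists_cutoff hq (half_pos hρ) (half_lt_self hρ)
      have h4 : ∀ᶠ z in 𝓝 (0 : ℂ), h z = q z := by
        filter_upwards [Metric.ball_mem_nhds (0 : ℂ) (half_pos (half_pos hρ))] with z hz
        exact h3 z (by simpa using hz)
      refine ⟨h, h1, h2, h4, ?_⟩
      filter_upwards [h4.eventually_nhds] with z hz using dbarTwo_congr hz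
  -- a first, rough expansion of `w`
  obtain ⟨a, ha⟩ : ∃ a : ℂ, (fun z => w z - a * z ^ m) =O[𝓝 0] fun z => ‖z‖ ^ m * √‖z‖ := by
    obtain ⟨h, h1, h2, h3, h4⟩ := hcut w hwρ
    obtain ⟨K, -, hK⟩ := exists_bound_dbarTwo h1 h2
    obtain ⟨a, ha⟩ := exists_leading_coeff h1 h2 m
      (exists_global_pow_bound hK (hdw.congr' h4.symm EventuallyEq.rfl))
      (hm.congr' h3.symm EventuallyEq.rfl)
    refine ⟨a, ha.congr' ?_ EventuallyEq.rfl⟩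
    filter_upwards [h3] with z hz
    rw [hz]
  -- subtracting the particular solution improves the order of the right-hand side
  obtain ⟨p, hp, hdp, hpo⟩ := exists_particular_solution A a m
  obtain ⟨b, hb⟩ : ∃ b : ℂ, (fun z => (w z - p z) - b * z ^ m) =O[𝓝 0] fun z => ‖z‖ ^ (m + 1) := by
    obtain ⟨h, h1, h2, h3, h4⟩ := hcut (fun z => w z - p z) fun z hz => (hwρ z hz).sub hp.contDiffAt
    obtain ⟨K, -, hK⟩ := exists_bound_dbarTwo h1 h2
    have hd : dbarTwo h =O[𝓝 0] fun z => ‖z‖ ^ m * √‖z‖ := by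
      have e1 : (fun z => (dbarTwo w z - A (w z)) + A (w z - a * z ^ m)) =O[𝓝 0]
          fun z => ‖z‖ ^ m * √‖z‖ :=
        ((heq.trans hzw).trans pow_succ_isBigO_pow_mul_sqrt).add ((hAw _).trans ha)
      refine e1.congr' ?_ EventuallyEq.rfl
      filter_upwards [h4, Metric.ball_mem_nhds (0 : ℂ) hρ] with z hz hzρ
      rw [hz, dbarTwo_sub ((hwρ z hzρ).differentiableAt one_ne_zero)
        (hp.differentiable one_ne_zero z), hdp, map_sub]
      ring
    obtain ⟨b, hb⟩ := exists_leading_coeff_of_sqrt h1 h2 m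
      (exists_global_bound (fun z => by positivity) (fun z z' h => by gcongr)
        (fun z hz => by have := norm_pos_iff.2 hz; positivity) hK hd)
      ((hm.sub (hpo.trans (pow_succ_isBigO_pow_mul_sqrt.trans hpowle))).congr' h3.symm
        EventuallyEq.rfl)
    refine ⟨b, hb.congr' ?_ EventuallyEq.rfl⟩
    filter_upwards [h3] with z hz
    rw [hz]
  have hfin : (fun z => w z - b * z ^ m) =O[𝓝 0] fun z => ‖z‖ ^ (m + 1) :=
    (hb.add hpo).congr_left fun z => by ring
  refine ⟨b, ?_, hfin⟩
  rintro rfl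
  exact hm' (by simpa using hfin)

end Analysis

/-! ### Division by a submersion and the normal component in coordinates -/

/-- Division by a submersion, to second order: a `C²` map `g` vanishing on the zero set of a
submersion `f : E → ℂ` is `L ∘ f` for a fixed linear map `L`, up to an error `O(|x - p| |f x|)`.
The local diffeomorphism `x ↦ x - p + σ (f x - f' (x - p))`, for a right inverse `σ` of
`f' = Df(p)`, turns `f` into the linear map `f'`. -/
theorem exists_linear_factor {E W : Type*} [NormedAddCommGroup E] [NormedSpace ℝ E]
    [FiniteDimensional ℝ E] [NormedAddCommGroup W] [NormedSpace ℝ W] {f : E → ℂ} {g : E → W}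
    {p : E} (hf : ContDiffAt ℝ 2 f p) (hg : ContDiffAt ℝ 2 g p) (hf0 : f p = 0)
    (hs : Function.Surjective (fderiv ℝ f p)) (hz : ∀ᶠ x in 𝓝 p, f x = 0 → g x = 0) :
    ∃ L : ℂ →L[ℝ] W, (fun x => g x - L (f x)) =O[𝓝 p] fun x => ‖x - p‖ * ‖f x‖ := by
  have := FiniteDimensional.complete ℝ E
  set f' := fderiv ℝ f p with hf'
  obtain ⟨σ₀, hσ₀⟩ := f'.toLinearMap.exists_rightInverse_of_surjective (LinearMap.range_eq_top.2 hs)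
  set σ : ℂ →L[ℝ] E := σ₀.toContinuousLinearMap
  have hσ : ∀ c, f' (σ c) = c := fun c => LinearMap.congr_fun hσ₀ c
  set Ψ : E → E := fun x => x - p + σ (f x - f' (x - p)) with hΨ
  have hΨs : ContDiffAt ℝ 2 Ψ p := by
    have h1 : ContDiffAt ℝ 2 (fun x => x - p) p := by fun_prop
    exact h1.add (σ.contDiff.contDiffAt.comp p (hf.sub (f'.contDiff.contDiffAt.comp p h1)))
  have hΨp : Ψ p = 0 := by simp [hΨ, hf0]
  have hΨf : ∀ x, f' (Ψ x) = f x := fun x => by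
    simp only [hΨ]
    rw [map_add, hσ]; ring
  have hΨ' : HasFDerivAt Ψ ((ContinuousLinearEquiv.refl ℝ E : E ≃L[ℝ] E) : E →L[ℝ] E) p := by
    have h1 : HasFDerivAt (fun x => x - p) (ContinuousLinearMap.id ℝ E) p :=
      (hasFDerivAt_id p).sub_const p
    have h2 : HasFDerivAt f f' p := (hf.differentiableAt two_ne_zero).hasFDerivAt
    have h3 := h1.add (σ.hasFDerivAt.comp p (h2.sub (f'.hasFDerivAt.comp p h1)))
    have h4 : ContinuousLinearMap.id ℝ E + σ ∘SL (f' - f' ∘SL ContinuousLinearMap.id ℝ E) =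
        ((ContinuousLinearEquiv.refl ℝ E : E ≃L[ℝ] E) : E →L[ℝ] E) := by
      ext e
      simp
    rw [← h4]
    exact h3
  have hstrict := hΨs.hasStrictFDerivAt' hΨ' two_ne_zero
  set inv : E → E := hΨs.localInverse hΨ' two_ne_zero
  have hinv : ContDiffAt ℝ 2 inv 0 := by
    have := hΨs.to_localInverse hΨ' two_ne_zero
    rwa [hΨp] at this
  have hleft : ∀ᶠ x in 𝓝 p, inv (Ψ x) = x := hstrict.eventually_left_inverse
  have hright : ∀ᶠ y in 𝓝 (0 : E), Ψ (inv y) = y := by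
    have := hstrict.eventually_right_inverse
    rwa [hΨp] at this
  have hinv0 : inv 0 = p := by
    have := hleft.self_of_nhds
    rwa [hΨp] at this
  set G : E → W := fun y => g (inv y)
  have hG : ContDiffAt ℝ 2 G 0 := by
    have h1 : ContDiffAt ℝ 2 g (inv 0) := by rwa [hinv0]
    exact h1.comp 0 hinv
  have hG0 : ∀ᶠ y in 𝓝 (0 : E), f' y = 0 → G y = 0 := by
    have h1 : Tendsto inv (𝓝 0) (𝓝 p) := by
      have := hinv.continuousAt.tendsto
      rwa [hinv0] at this
    filter_upwards [h1.eventually hz, hright] with y h2 h3 h4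
    refine h2 ?_
    rw [← hΨf, h3, h4]
  have hGd : ∀ᶠ y in 𝓝 (0 : E), DifferentiableAt ℝ G y :=
    (hG.eventually (by decide)).mono fun y hy => hy.differentiableAt two_ne_zero
  have hG' : (fun y => fderiv ℝ G y - fderiv ℝ G 0) =O[𝓝 0] fun y => y - 0 :=
    ((hG.fderiv_right (m := 1) (by norm_num)).differentiableAt one_ne_zero).isBigO_sub
  obtain ⟨C, hC, hCb⟩ := hG'.exists_nonneg
  obtain ⟨δ, hδ, hball⟩ := Metric.eventually_nhds_iff_ball.1 (hG0.and (hGd.and hCb.bound))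
  set T : E →L[ℝ] E := σ.comp f'
  set c : ℝ := 1 + ‖T‖
  have hc : 0 < c := by positivity
  have main : (fun y => G y - (fderiv ℝ G 0).comp σ (f' y)) =O[𝓝 0] fun y => ‖y‖ * ‖f' y‖ := by
    refine IsBigO.of_bound (C * c * ‖σ‖) ?_
    filter_upwards [Metric.ball_mem_nhds (0 : E) (div_pos hδ hc)] with y hy
    have hcy : c * ‖y‖ < δ := by
      rw [mem_ball_zero_iff, lt_div_iff₀ hc] at hy; linarith
    have hsub : Metric.closedBall (0 : E) (c * ‖y‖) ⊆ Metric.ball 0 δ :=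
      Metric.closedBall_subset_ball hcy
    have hy1 : y ∈ Metric.closedBall (0 : E) (c * ‖y‖) := by
      rw [mem_closedBall_zero_iff]
      exact le_mul_of_one_le_left (norm_nonneg y) (by simp [c])
    have hy2 : y - T y ∈ Metric.closedBall (0 : E) (c * ‖y‖) := by
      rw [mem_closedBall_zero_iff]
      calc ‖y - T y‖ ≤ ‖y‖ + ‖T‖ * ‖y‖ := (norm_sub_le _ _).trans (by gcongr; exact T.le_opNorm y)
        _ = c * ‖y‖ := by simp only [c]; ring
    have h1 := (convex_closedBall (0 : E) (c * ‖y‖)).norm_image_sub_le_of_norm_fderiv_le'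
      (f := G) (φ := fderiv ℝ G 0) (C := C * (c * ‖y‖)) (fun x hx => (hball x (hsub hx)).2.1)
      (fun x hx => by
        have := (hball x (hsub hx)).2.2
        rw [sub_zero] at this
        exact this.trans (by gcongr; simpa using hx)) hy2 hy1
    have h2 : G (y - T y) = 0 := by
      refine (hball _ (hsub hy2)).1 ?_
      rw [map_sub]; simp only [T, ContinuousLinearMap.comp_apply, hσ, sub_self]
    rw [h2, sub_zero, sub_sub_cancel] at h1
    rw [Real.norm_of_nonneg (by positivity)]
    calc ‖G y - (fderiv ℝ G 0).comp σ (f' y)‖ ≤ C * (c * ‖y‖) * ‖T y‖ := h1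
      _ ≤ C * (c * ‖y‖) * (‖σ‖ * ‖f' y‖) := by gcongr; exact σ.le_opNorm _
      _ = _ := by ring
  refine ⟨(fderiv ℝ G 0).comp σ, ?_⟩
  have hΨt : Tendsto Ψ (𝓝 p) (𝓝 0) := by
    have := hΨs.continuousAt.tendsto
    rwa [hΨp] at this
  have hΨO : (fun x => ‖Ψ x‖ * ‖f x‖) =O[𝓝 p] fun x => ‖x - p‖ * ‖f x‖ := by
    have h1 : (fun x => Ψ x - Ψ p) =O[𝓝 p] fun x => x - p := hΨ'.isBigO_sub
    rw [hΨp] at h1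
    simp only [sub_zero] at h1
    exact h1.norm_norm.mul (isBigO_refl _ _)
  refine ((main.comp_tendsto hΨt).congr' ?_ ?_).trans hΨO
  · filter_upwards [hleft] with x hx
    simp only [Function.comp_apply, hΨf, G, hx]
  · filter_upwards with x
    simp only [Function.comp_apply, hΨf]

/-- The normal component of a pseudoholomorphic curve in local coordinates: the deviation of the
normal coordinate `Z` from being `J`-holomorphic vanishes on `Z = 0`, hence is linear in `Z` up to
higher order, and `Z ∘ v` solves a perturbed Cauchy–Riemann equation. -/
theorem eventually_eq_zero_or_leading_monomial_comp {E : Type*} [NormedAddCommGroup E]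
    [NormedSpace ℝ E] [FiniteDimensional ℝ E] {Z : E → ℂ} {J : E → E →L[ℝ] E} {v : ℂ → E} {z₀ : ℂ}
    (hZ : ContDiffAt ℝ 3 Z (v z₀)) (hJ : ContDiffAt ℝ 2 J (v z₀)) (hv : ContDiffAt ℝ 2 v z₀)
    (hZ0 : Z (v z₀) = 0) (hs : Function.Surjective (fderiv ℝ Z (v z₀)))
    (hlin : ∀ᶠ x in 𝓝 (v z₀), Z x = 0 →
      ∀ e, fderiv ℝ Z x (J x e) = Complex.I * fderiv ℝ Z x e)
    (hhol : ∀ᶠ z in 𝓝 z₀, fderiv ℝ v z Complex.I = J (v z) (fderiv ℝ v z 1)) :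
    (∀ᶠ z in 𝓝 z₀, Z (v z) = 0) ∨ ∃ m : ℕ, 0 < m ∧ ∃ a : ℂ, a ≠ 0 ∧
      (fun z => Z (v z) - a * (z - z₀) ^ m) =O[𝓝 z₀] fun z => ‖z - z₀‖ ^ (m + 1) := by
  wlog hz0 : z₀ = 0 generalizing v z₀
  · have ht : Tendsto (fun z : ℂ => z + z₀) (𝓝 0) (𝓝 z₀) := by
      simpa using (by fun_prop : Continuous fun z : ℂ => z + z₀).tendsto 0
    have ht' : Tendsto (fun z : ℂ => z - z₀) (𝓝 z₀) (𝓝 0) := by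
      simpa using (by fun_prop : Continuous fun z : ℂ => z - z₀).tendsto z₀
    have e0 : v (0 + z₀) = v z₀ := by rw [zero_add]
    have := this (v := fun z => v (z + z₀)) (z₀ := 0) (by simpa using hZ) (by simpa using hJ)
      (by
        have h1 : ContDiffAt ℝ 2 v (0 + z₀) := by simpa using hv
        exact h1.comp (0 : ℂ) (by fun_prop)) (by simpa using hZ0) (by simpa using hs)
      (by simpa using hlin)
      (by
        filter_upwards [ht.eventually hhol] with z hz
        simpa only [fderiv_comp_add_right] using hz) rfl
    rcases this with h | ⟨m, hm, a, ha, h⟩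
    · left
      filter_upwards [ht'.eventually h] with z hz
      simpa using hz
    · refine Or.inr ⟨m, hm, a, ha, ?_⟩
      simpa [Function.comp_def] using h.comp_tendsto ht'
  subst hz0
  have hZ' : ContDiffAt ℝ 2 (fderiv ℝ Z) (v 0) := hZ.fderiv_right (by norm_num)
  set Q : E → E →L[ℝ] ℂ := fun x => (fderiv ℝ Z x).comp (J x) - Complex.I • fderiv ℝ Z x
  have hQ : ContDiffAt ℝ 2 Q (v 0) := (hZ'.clm_comp hJ).sub (hZ'.const_smul Complex.I)
  obtain ⟨L, hL⟩ := exists_linear_factor (hZ.of_le (by norm_num)) hQ hZ0 hs <| by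
    filter_upwards [hlin] with x hx h0
    ext e
    simp [Q, hx h0 e]
  have hvt : Tendsto v (𝓝 0) (𝓝 (v 0)) := hv.continuousAt
  set w : ℂ → ℂ := fun z => Z (v z)
  have hvO : (fun z => v z - v 0) =O[𝓝 0] fun z => z := by
    simpa using (hv.differentiableAt two_ne_zero).isBigO_sub
  have hLv : (fun z => Q (v z) - L (w z)) =O[𝓝 0] fun z => ‖z‖ * ‖w z‖ :=
    (hL.comp_tendsto hvt).trans (hvO.norm_norm.mul (isBigO_refl _ _))
  have hdv : (fun z => fderiv ℝ v z 1 - fderiv ℝ v 0 1) =O[𝓝 0] fun z => z := by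
    have h1 : ContDiffAt ℝ 1 (fun z => fderiv ℝ v z 1) 0 :=
      (hv.fderiv_right (m := 1) (by norm_num)).clm_apply contDiffAt_const
    simpa using (h1.differentiableAt one_ne_zero).isBigO_sub
  have hdv1 : (fun z => fderiv ℝ v z 1) =O[𝓝 0] fun _ => (1 : ℝ) := by
    have h1 : ContDiffAt ℝ 1 (fun z => fderiv ℝ v z 1) 0 :=
      (hv.fderiv_right (m := 1) (by norm_num)).clm_apply contDiffAt_const
    exact h1.continuousAt.isBigO_one ℝ
  set A : ℂ →L[ℝ] ℂ := Complex.I • (L.flip (fderiv ℝ v 0 1))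
  have hbil : ∀ (S : ℂ → E →L[ℝ] ℂ) (e : ℂ → E),
      (fun z => S z (e z)) =O[𝓝 0] fun z => ‖S z‖ * ‖e z‖ := fun S e =>
    IsBigO.of_bound 1 (Eventually.of_forall fun z => by
      rw [one_mul, Real.norm_of_nonneg (by positivity)]; exact (S z).le_opNorm _)
  simp only [sub_zero]
  refine eventually_eq_zero_or_leading_monomial (w := w)
    ((hZ.of_le (by norm_num)).comp (0 : ℂ) (hv.of_le (by norm_num))) hZ0 A ?_
  have heq : ∀ᶠ z in 𝓝 (0 : ℂ), dbarTwo w z - A (w z) = Complex.I *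
      ((Q (v z) - L (w z)) (fderiv ℝ v z 1) + L (w z) (fderiv ℝ v z 1 - fderiv ℝ v 0 1)) := by
    have hZd : ∀ᶠ x in 𝓝 (v 0), DifferentiableAt ℝ Z x :=
      (hZ.eventually (by decide)).mono fun x hx => hx.differentiableAt three_ne_zero
    have hvd : ∀ᶠ z in 𝓝 (0 : ℂ), DifferentiableAt ℝ v z :=
      (hv.eventually (by decide)).mono fun x hx => hx.differentiableAt two_ne_zero
    filter_upwards [hhol, hvt.eventually hZd, hvd] with z h1 h2 h3
    have h4 : fderiv ℝ w z = (fderiv ℝ Z (v z)).comp (fderiv ℝ v z) := fderiv_comp z h2 h3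
    simp only [dbarTwo, h4, ContinuousLinearMap.comp_apply, h1, A, Q, sub_apply,
      smul_apply, ContinuousLinearMap.flip_apply, map_sub, smul_eq_mul]
    ring_nf
    simp only [Complex.I_sq]
    ring
  have h1 : (fun z => (Q (v z) - L (w z)) (fderiv ℝ v z 1)) =O[𝓝 0] fun z => ‖z‖ * ‖w z‖ := by
    simpa using (hbil _ _).trans (hLv.norm_left.mul hdv1.norm_left)
  have h2 : (fun z => L (w z) (fderiv ℝ v z 1 - fderiv ℝ v 0 1)) =O[𝓝 0]
      fun z => ‖z‖ * ‖w z‖ := by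
    refine (hbil _ _).trans ?_
    simpa [mul_comm] using (L.isBigO_comp w (𝓝 0)).norm_norm.mul hdv.norm_norm
  refine (((h1.add h2).const_mul_left Complex.I)).congr' ?_ EventuallyEq.rfl
  filter_upwards [heq] with z hz using hz.symm

/-! ### Almost complex structures in charts -/

section Charts

variable {E : Type*} [NormedAddCommGroup E] [NormedSpace ℝ E]
  {M : Type*} [TopologicalSpace M] [ChartedSpace E M]
  {e : OpenPartialHomeomorph M E}

lemma mdifferentiable_of_mem_maximalAtlas
    (he : e ∈ IsManifold.maximalAtlas 𝓘(ℝ, E) ∞ M) : e.MDifferentiable 𝓘(ℝ, E) 𝓘(ℝ, E) :=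
  ⟨(contMDiffOn_of_mem_maximalAtlas he).mdifferentiableOn (by simp),
    (contMDiffOn_symm_of_mem_maximalAtlas he).mdifferentiableOn (by simp)⟩

lemma mfderiv_chart_symm_apply (he : e ∈ IsManifold.maximalAtlas 𝓘(ℝ, E) ∞ M) {x : M}
    (hx : x ∈ e.source) (v : TangentSpace 𝓘(ℝ, E) x) :
    mfderiv 𝓘(ℝ, E) 𝓘(ℝ, E) e.symm (e x) (mfderiv 𝓘(ℝ, E) 𝓘(ℝ, E) e x v) = v :=
  DFunLike.congr_fun ((mdifferentiable_of_mem_maximalAtlas he).symm_comp_deriv hx) v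

lemma mfderiv_symm_chart_apply (he : e ∈ IsManifold.maximalAtlas 𝓘(ℝ, E) ∞ M) {y : E}
    (hy : y ∈ e.target) (v : E) :
    mfderiv 𝓘(ℝ, E) 𝓘(ℝ, E) e (e.symm y) (mfderiv 𝓘(ℝ, E) 𝓘(ℝ, E) e.symm y v) = v :=
  DFunLike.congr_fun ((mdifferentiable_of_mem_maximalAtlas he).comp_symm_deriv hy) v

variable [IsManifold 𝓘(ℝ, E) ∞ M]

/-- The almost complex structure `J` read in the chart `e`. -/
noncomputable def AlmostComplexStructure.inChart (J : AlmostComplexStructure E M)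
    (e : OpenPartialHomeomorph M E) (y : E) : E →L[ℝ] E :=
  (mfderiv 𝓘(ℝ, E) 𝓘(ℝ, E) e (e.symm y)).comp
    ((J.toFun (e.symm y)).comp (mfderiv 𝓘(ℝ, E) 𝓘(ℝ, E) e.symm y))

variable (J : AlmostComplexStructure E M)

/-- In a chart, `J` becomes left composition with `J.inChart`. -/
lemma AlmostComplexStructure.inChart_apply (he : e ∈ IsManifold.maximalAtlas 𝓘(ℝ, E) ∞ M) {x : M}
    (hx : x ∈ e.source) (v : TangentSpace 𝓘(ℝ, E) x) :
    J.inChart e (e x) (mfderiv 𝓘(ℝ, E) 𝓘(ℝ, E) e x v) =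
      mfderiv 𝓘(ℝ, E) 𝓘(ℝ, E) e x (J.toFun x v) := by
  have h : ∀ x', x' = x → (mfderiv 𝓘(ℝ, E) 𝓘(ℝ, E) e x' : E →L[ℝ] E)
      ((J.toFun x' : E →L[ℝ] E) ((mfderiv 𝓘(ℝ, E) 𝓘(ℝ, E) e.symm (e x) : E →L[ℝ] E)
        ((mfderiv 𝓘(ℝ, E) 𝓘(ℝ, E) e x : E →L[ℝ] E) v))) =
      mfderiv 𝓘(ℝ, E) 𝓘(ℝ, E) e x (J.toFun x v) := by
    rintro _ rfl
    exact congrArg (fun w => mfderiv 𝓘(ℝ, E) 𝓘(ℝ, E) e _ (J.toFun _ w))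
      (mfderiv_chart_symm_apply he hx v)
  exact h _ (e.left_inv hx)

lemma AlmostComplexStructure.inChart_inChart (he : e ∈ IsManifold.maximalAtlas 𝓘(ℝ, E) ∞ M) {y : E}
    (hy : y ∈ e.target) (v : E) : J.inChart e y (J.inChart e y v) = -v := by
  obtain ⟨x, hx, rfl⟩ : ∃ x ∈ e.source, e x = y := ⟨e.symm y, e.map_target hy, e.right_inv hy⟩
  obtain ⟨w, rfl⟩ := (mdifferentiable_of_mem_maximalAtlas he).mfderiv_surjective hx v
  rw [J.inChart_apply he hx, J.inChart_apply he hx, J.sq_eq_neg, map_neg]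
  rfl

lemma AlmostComplexStructure.contDiffAt_inChart [FiniteDimensional ℝ E]
    (he : e ∈ IsManifold.maximalAtlas 𝓘(ℝ, E) ∞ M) {y : E} (hy : y ∈ e.target) :
    ContDiffAt ℝ ∞ (J.inChart e) y := by
  have := FiniteDimensional.complete ℝ E
  have : IsManifold 𝓘(ℝ, E) 1 M := IsManifold.of_le (n := ∞) (by simp)
  have hmd := mdifferentiable_of_mem_maximalAtlas he
  suffices h : ContDiffOn ℝ ∞ (J.inChart e) e.target from
    h.contDiffAt (e.open_target.mem_nhds hy)
  refine contDiffOn_clm_apply.2 fun v y hy => ContDiffAt.contDiffWithinAt ?_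
  -- `J` maps the vector field which is constant in the chart to a smooth vector field
  set x := e.symm y with hxdef
  have hx : x ∈ e.source := e.map_target hy
  have hinv : ∀ x ∈ e.source, (mfderiv 𝓘(ℝ, E) 𝓘(ℝ, E) e x).IsInvertible := fun x hx =>
    ⟨hmd.mfderiv hx, rfl⟩
  have hinv' : ∀ y ∈ e.target, (mfderiv 𝓘(ℝ, E) 𝓘(ℝ, E) e.symm y).IsInvertible := fun y hy =>
    ⟨hmd.symm.mfderiv hy, rfl⟩
  let V : (y : E) → TangentSpace 𝓘(ℝ, E) y := fun _ => v
  have h1 : ContMDiffAt 𝓘(ℝ, E) 𝓘(ℝ, E).tangent ∞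
      (fun y => (⟨y, V y⟩ : TangentBundle 𝓘(ℝ, E) E)) (e x) :=
    contMDiffAt_vectorSpace_iff_contDiffAt.2 contDiffAt_const
  have h2 := ContMDiffAt.mpullback_vectorField_preimage (n := ∞) h1
    (contMDiffAt_of_mem_maximalAtlas he hx) (hinv x hx) le_rfl
  have h3 := ContMDiffAt.clm_bundle_apply (J.smooth x) h2
  have h4 := ContMDiffAt.mpullback_vectorField_preimage (n := ∞) (f := e.symm) (x₀ := y) h3
    (contMDiffAt_symm_of_mem_maximalAtlas he hy) (hinv' y hy) le_rfl
  refine (contMDiffAt_vectorSpace_iff_contDiffAt.1 h4).congr_of_eventuallyEq ?_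
  filter_upwards [e.open_target.mem_nhds hy] with y hy
  obtain ⟨A, hA⟩ := hinv' y hy
  obtain ⟨B, hB⟩ := hinv _ (e.map_target hy)
  have hAB : ∀ w, B (A w) = w := fun w => by
    have := mfderiv_symm_chart_apply he hy w
    rwa [← hA, ← hB] at this
  have e1 : VectorField.mpullback 𝓘(ℝ, E) 𝓘(ℝ, E) e V (e.symm y) = A (v : E) := by
    rw [VectorField.mpullback_apply, ← hB, ContinuousLinearMap.inverse_equiv]
    exact (B.symm_apply_eq).2 (hAB v).symm
  have e2 : ∀ w, (mfderiv 𝓘(ℝ, E) 𝓘(ℝ, E) e.symm y).inverse w =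
      mfderiv 𝓘(ℝ, E) 𝓘(ℝ, E) e (e.symm y) w := fun w => by
    rw [← hA, ← hB, ContinuousLinearMap.inverse_equiv]
    obtain ⟨w, rfl⟩ := A.surjective w
    exact (A.symm_apply_apply w).trans (hAB w).symm
  rw [VectorField.mpullback_apply, e2, e1]
  exact congrArg (fun T : E →L[ℝ] E => (mfderiv 𝓘(ℝ, E) 𝓘(ℝ, E) e (e.symm y) : E →L[ℝ] E)
    ((J.toFun (e.symm y) : E →L[ℝ] E) (T v))) hA.symm

end Charts

/-! ### Normal coordinates and pseudoholomorphic curves in charts -/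

lemma eventuallyEq_comp_chart {X Y : Type*} [TopologicalSpace X] [TopologicalSpace Y]
    {e : OpenPartialHomeomorph X Y} {x : X} (hx : x ∈ e.source) (ζ : X → ℂ) :
    ζ =ᶠ[𝓝 x] (ζ ∘ e.symm) ∘ e := by
  filter_upwards [e.open_source.mem_nhds hx] with y hy
  simp [e.left_inv hy]

section NormalCoordinates

variable {E : Type*} [NormedAddCommGroup E] [NormedSpace ℝ E]
  {M : Type*} [TopologicalSpace M] [ChartedSpace E M]
  {e : OpenPartialHomeomorph M E}

lemma mvfderiv_eq_fderiv_chart (he : e ∈ IsManifold.maximalAtlas 𝓘(ℝ, E) ∞ M) {x : M}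
    (hx : x ∈ e.source) {ζ : M → ℂ} {Z : E → ℂ} (hZ : DifferentiableAt ℝ Z (e x))
    (h : ζ =ᶠ[𝓝 x] Z ∘ e) (v : TangentSpace 𝓘(ℝ, E) x) :
    mvfderiv 𝓘(ℝ, E) ζ x v = fderiv ℝ Z (e x) (mfderiv 𝓘(ℝ, E) 𝓘(ℝ, E) e x v) := by
  have h1 : mfderiv 𝓘(ℝ, E) 𝓘(ℝ, ℂ) (Z ∘ e) x =
      (mfderiv 𝓘(ℝ, E) 𝓘(ℝ, ℂ) Z (e x)).comp (mfderiv 𝓘(ℝ, E) 𝓘(ℝ, E) e x) :=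
    mfderiv_comp x hZ.mdifferentiableAt
      ((mdifferentiable_of_mem_maximalAtlas he).mdifferentiableAt hx)
  have h2 : (mfderiv 𝓘(ℝ, E) 𝓘(ℝ, ℂ) ζ x : E →L[ℝ] ℂ) = mfderiv 𝓘(ℝ, E) 𝓘(ℝ, ℂ) (Z ∘ e) x :=
    h.mfderiv_eq
  rw [mfderiv_eq_fderiv] at h1
  have h3 : mvfderiv 𝓘(ℝ, E) ζ x v = (mfderiv 𝓘(ℝ, E) 𝓘(ℝ, ℂ) ζ x : E →L[ℝ] ℂ) v := rfl
  rw [h3, h2, h1]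
  rfl

lemma contDiffAt_comp_chart_symm (he : e ∈ IsManifold.maximalAtlas 𝓘(ℝ, E) ∞ M) {x : M}
    (hx : x ∈ e.source) {ζ : M → ℂ} (hζ : ContMDiffAt 𝓘(ℝ, E) 𝓘(ℝ, ℂ) ∞ ζ x) :
    ContDiffAt ℝ ∞ (ζ ∘ e.symm) (e x) := by
  have h1 : ContMDiffAt 𝓘(ℝ, E) 𝓘(ℝ, ℂ) ∞ ζ (e.symm (e x)) := by rwa [e.left_inv hx]
  exact (h1.comp (e x) (contMDiffAt_symm_of_mem_maximalAtlas he (e.map_source hx))).contDiffAt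

lemma surjective_iff_chart (he : e ∈ IsManifold.maximalAtlas 𝓘(ℝ, E) ∞ M) {x : M}
    (hx : x ∈ e.source) {ζ : M → ℂ} {Z : E → ℂ} (hZ : DifferentiableAt ℝ Z (e x))
    (h : ζ =ᶠ[𝓝 x] Z ∘ e) :
    Function.Surjective (mvfderiv 𝓘(ℝ, E) ζ x) ↔ Function.Surjective (fderiv ℝ Z (e x)) := by
  refine ⟨fun H c => ?_, fun H c => ?_⟩
  · obtain ⟨v, hv⟩ := H c
    exact ⟨_, (mvfderiv_eq_fderiv_chart he hx hZ h v).symm.trans hv⟩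
  · obtain ⟨w, rfl⟩ := H c
    obtain ⟨v, rfl⟩ := (mdifferentiable_of_mem_maximalAtlas he).mfderiv_surjective hx w
    exact ⟨v, mvfderiv_eq_fderiv_chart he hx hZ h v⟩

variable [IsManifold 𝓘(ℝ, E) ∞ M] {J : AlmostComplexStructure E M}

lemma complexLinear_iff_inChart (he : e ∈ IsManifold.maximalAtlas 𝓘(ℝ, E) ∞ M) {x : M}
    (hx : x ∈ e.source) {ζ : M → ℂ} {Z : E → ℂ} (hZ : DifferentiableAt ℝ Z (e x))
    (h : ζ =ᶠ[𝓝 x] Z ∘ e) :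
    (∀ v : TangentSpace 𝓘(ℝ, E) x,
        mvfderiv 𝓘(ℝ, E) ζ x (J.toFun x v) = Complex.I * mvfderiv 𝓘(ℝ, E) ζ x v) ↔
      ∀ w : E, fderiv ℝ Z (e x) (J.inChart e (e x) w) = Complex.I * fderiv ℝ Z (e x) w := by
  refine ⟨fun H w => ?_, fun H v => ?_⟩
  · obtain ⟨v, rfl⟩ := (mdifferentiable_of_mem_maximalAtlas he).mfderiv_surjective hx w
    have := H v
    rw [mvfderiv_eq_fderiv_chart he hx hZ h, mvfderiv_eq_fderiv_chart he hx hZ h,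
      ← J.inChart_apply he hx] at this
    exact this
  · rw [mvfderiv_eq_fderiv_chart he hx hZ h, mvfderiv_eq_fderiv_chart he hx hZ h,
      ← J.inChart_apply he hx]
    exact H _

/-- A normal coordinate may be given in a chart. -/
lemma IsNormalCoordinate.of_chart (he : e ∈ IsManifold.maximalAtlas 𝓘(ℝ, E) ∞ M) {p : M}
    (hp : p ∈ e.source) {A : Set M} {Z : E → ℂ} {V : Set E} (hV : IsOpen V) (hpV : e p ∈ V)
    (hZ : ContDiffOn ℝ ∞ Z V) (hA : ∀ y ∈ V, Z y = 0 ↔ e.symm y ∈ A)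
    (hs : ∀ y ∈ V, Z y = 0 → Function.Surjective (fderiv ℝ Z y))
    (hl : ∀ y ∈ V, Z y = 0 → ∀ w, fderiv ℝ Z y (J.inChart e y w) = Complex.I * fderiv ℝ Z y w) :
    IsNormalCoordinate J A p (e.source ∩ e ⁻¹' V) (Z ∘ e) := by
  have hd : ∀ y ∈ V, DifferentiableAt ℝ Z y := fun y hy =>
    (hZ.contDiffAt (hV.mem_nhds hy)).differentiableAt (by simp)
  have hA' : ∀ x ∈ e.source ∩ e ⁻¹' V, (Z ∘ e) x = 0 ↔ x ∈ A := fun x hx => by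
    rw [Function.comp_apply, hA _ hx.2, e.left_inv hx.1]
  refine ⟨e.isOpen_inter_preimage hV, ⟨hp, hpV⟩, ?_, hA', fun x hx => ?_, fun x hx => ?_⟩
  · exact hZ.contMDiffOn.comp ((contMDiffOn_of_mem_maximalAtlas he).mono inter_subset_left)
      fun x hx => hx.2
  · exact (surjective_iff_chart he hx.1.1 (hd _ hx.1.2) EventuallyEq.rfl).2
      (hs _ hx.1.2 ((hA' x hx.1).2 hx.2))
  · exact (complexLinear_iff_inChart he hx.1.1 (hd _ hx.1.2) EventuallyEq.rfl).2
      (hl _ hx.1.2 ((hA' x hx.1).2 hx.2))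

section

variable {A : Set M} {p : M} {U : Set M} {ζ : M → ℂ}

lemma IsNormalCoordinate.contMDiffAt (h : IsNormalCoordinate J A p U ζ) {x : M} (hx : x ∈ U) :
    ContMDiffAt 𝓘(ℝ, E) 𝓘(ℝ, ℂ) ∞ ζ x :=
  h.contMDiffOn.contMDiffAt (h.isOpen.mem_nhds hx)

lemma IsNormalCoordinate.eventually_zero_iff (h : IsNormalCoordinate J A p U ζ)
    (hp : p ∈ e.source) : ∀ᶠ y in 𝓝 (e p), (ζ ∘ e.symm) y = 0 ↔ e.symm y ∈ A := by
  have ht : Tendsto e.symm (𝓝 (e p)) (𝓝 p) := by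
    simpa [e.left_inv hp] using (e.continuousAt_symm (e.map_source hp)).tendsto
  filter_upwards [ht.eventually (h.isOpen.mem_nhds h.mem)] with y hy
  exact h.eq_zero_iff _ hy

lemma IsNormalCoordinate.surjective_chart (h : IsNormalCoordinate J A p U ζ)
    (he : e ∈ IsManifold.maximalAtlas 𝓘(ℝ, E) ∞ M) (hp : p ∈ e.source) (hpA : p ∈ A) :
    Function.Surjective (fderiv ℝ (ζ ∘ e.symm) (e p)) :=
  (surjective_iff_chart he hp
    ((contDiffAt_comp_chart_symm he hp (h.contMDiffAt h.mem)).differentiableAt (by simp))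
    (eventuallyEq_comp_chart hp ζ)).1 (h.surjective p ⟨h.mem, hpA⟩)

lemma IsNormalCoordinate.complexLinear_chart (h : IsNormalCoordinate J A p U ζ)
    (he : e ∈ IsManifold.maximalAtlas 𝓘(ℝ, E) ∞ M) (hp : p ∈ e.source) :
    ∀ᶠ y in 𝓝 (e p), (ζ ∘ e.symm) y = 0 → ∀ w,
      fderiv ℝ (ζ ∘ e.symm) y (J.inChart e y w) = Complex.I * fderiv ℝ (ζ ∘ e.symm) y w := by
  have ht : Tendsto e.symm (𝓝 (e p)) (𝓝 p) := by
    simpa [e.left_inv hp] using (e.continuousAt_symm (e.map_source hp)).tendsto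
  filter_upwards [ht.eventually (h.isOpen.mem_nhds h.mem),
    e.open_target.mem_nhds (e.map_source hp)] with y hy hyt h0
  have hx : e.symm y ∈ e.source := e.map_target hyt
  have := (complexLinear_iff_inChart he hx
    ((contDiffAt_comp_chart_symm he hx (h.contMDiffAt hy)).differentiableAt (by simp))
    (eventuallyEq_comp_chart hx ζ)).1 (h.complexLinear _ ⟨hy, (h.eq_zero_iff _ hy).1 h0⟩)
  rwa [e.right_inv hyt] at this

/-- Nonzero multiples of normal coordinates are normal coordinates. -/
lemma IsNormalCoordinate.const_mul (h : IsNormalCoordinate J A p U ζ) {a : ℂ} (ha : a ≠ 0) :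
    IsNormalCoordinate J A p U (fun x => a * ζ x) := by
  have hd : ∀ x ∈ U, ∀ v, mvfderiv 𝓘(ℝ, E) (fun x => a * ζ x) x v =
      a * mvfderiv 𝓘(ℝ, E) ζ x v := fun x hx v => by
    have he : chartAt E x ∈ IsManifold.maximalAtlas 𝓘(ℝ, E) ∞ M :=
      IsManifold.chart_mem_maximalAtlas x
    have hxs := mem_chart_source E x
    have hZ := (contDiffAt_comp_chart_symm he hxs (h.contMDiffAt hx)).differentiableAt (by simp)
    have h1 := eventuallyEq_comp_chart hxs ζ
    rw [mvfderiv_eq_fderiv_chart he hxs hZ h1, mvfderiv_eq_fderiv_chart he hxs (hZ.const_mul a)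
      (h1.mono fun y hy => congrArg (a * ·) hy), fderiv_const_mul hZ]
    rfl
  have hmul : ContDiff ℝ ∞ fun c : ℂ => a * c := contDiff_const.mul contDiff_id
  refine ⟨h.isOpen, h.mem, hmul.contMDiff.comp_contMDiffOn
    h.contMDiffOn, fun x hx => ?_, fun x hx c => ?_,
    fun x hx v => ?_⟩
  · rw [mul_eq_zero, or_iff_right ha, h.eq_zero_iff x hx]
  · obtain ⟨v, hv⟩ := h.surjective x hx (a⁻¹ * c)
    exact ⟨v, by rw [hd x hx.1, hv, mul_inv_cancel_left₀ ha]⟩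
  · rw [hd x hx.1, hd x hx.1, h.complexLinear x hx]
    ring

end

/-- The Cauchy–Riemann equation of a pseudoholomorphic curve, in a chart. -/
lemma IsPseudoholomorphicOn.fderiv_chart {u : ℂ → M} {Ω : Set ℂ} (hu : IsPseudoholomorphicOn J u Ω)
    (hΩ : IsOpen Ω) (he : e ∈ IsManifold.maximalAtlas 𝓘(ℝ, E) ∞ M) {z : ℂ} (hz : z ∈ Ω)
    (hze : u z ∈ e.source) :
    fderiv ℝ (e ∘ u) z Complex.I = J.inChart e (e (u z)) (fderiv ℝ (e ∘ u) z 1) := by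
  have h1 : mfderiv 𝓘(ℝ, ℂ) 𝓘(ℝ, E) (e ∘ u) z =
      (mfderiv 𝓘(ℝ, E) 𝓘(ℝ, E) e (u z)).comp (mfderiv 𝓘(ℝ, ℂ) 𝓘(ℝ, E) u z) :=
    mfderiv_comp z ((mdifferentiable_of_mem_maximalAtlas he).mdifferentiableAt hze)
      ((hu.contMDiffOn.contMDiffAt (hΩ.mem_nhds hz)).mdifferentiableAt two_ne_zero)
  rw [mfderiv_eq_fderiv] at h1
  have h2 := hu.holomorphic z hz 1
  rw [mul_one] at h2
  have h3 := J.inChart_apply he hze (mfderiv 𝓘(ℝ, ℂ) 𝓘(ℝ, E) u z (1 : ℂ))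
  rw [← h2] at h3
  rw [h1]
  exact h3.symm

lemma IsPseudoholomorphicOn.contDiffAt_chart {u : ℂ → M} {Ω : Set ℂ}
    (hu : IsPseudoholomorphicOn J u Ω) (hΩ : IsOpen Ω)
    (he : e ∈ IsManifold.maximalAtlas 𝓘(ℝ, E) ∞ M) {z : ℂ} (hz : z ∈ Ω) (hze : u z ∈ e.source) :
    ContDiffAt ℝ 2 (e ∘ u) z := by
  have h1 : ContMDiffAt 𝓘(ℝ, E) 𝓘(ℝ, E) 2 e (u z) :=
    (contMDiffAt_of_mem_maximalAtlas he hze).of_le ENat.LEInfty.out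
  exact (h1.comp z (hu.contMDiffOn.contMDiffAt (hΩ.mem_nhds hz))).contDiffAt

end NormalCoordinates

/-! ### Existence of normal coordinates -/

/-- A complex structure `j` on the real plane `ℂ` is identified with multiplication by `i` through
the linear isomorphism `k ↦ re k - i re (j k)`. -/
lemma injective_re_sub_I_mul_re {j : ℂ →L[ℝ] ℂ} (hj : ∀ k, j (j k) = -k) {k : ℂ}
    (h : (k.re : ℂ) - Complex.I * (j k).re = 0) : k = 0 := by
  have h1 : k.re = 0 := by simpa using congrArg Complex.re h
  have h2 : (j k).re = 0 := by simpa using congrArg Complex.im h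
  by_contra hk
  have h3 : k.im ≠ 0 := fun h3 => hk (Complex.ext h1 h3)
  -- both `k` and `j k` are purely imaginary, so `j` has a real eigenvalue
  obtain ⟨t, h4⟩ : ∃ t : ℝ, j k = t • k := by
    refine ⟨(j k).im / k.im, Complex.ext ?_ ?_⟩
    · simp [h1, h2]
    · simp [h3]
  have h5 := congrArg Complex.im (hj k)
  rw [h4, map_smul, h4] at h5
  simp only [Complex.smul_im, smul_eq_mul, Complex.neg_im] at h5
  have h6 : t * t = -1 := mul_right_cancel₀ h3 (by linarith)
  nlinarith [mul_self_nonneg t]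

/-- Normal coordinates exist for a linear hypersurface `c = 0` of real codimension two which is
almost complex for a variable complex structure `J`: compose `c` with identifications of the
normal spaces with `ℂ` which are complex linear along `c = 0`. -/
lemma exists_normal_function {E : Type*} [NormedAddCommGroup E] [NormedSpace ℝ E]
    {J : E → E →L[ℝ] E} {c : E →L[ℝ] ℂ} {q : E} (hc : Function.Surjective c) (hcq : c q = 0)
    (hJ : ∀ᶠ y in 𝓝 q, ContDiffAt ℝ ∞ J y) (hJ2 : ∀ᶠ y in 𝓝 q, ∀ v, J y (J y v) = -v)
    (hinv : ∀ᶠ y in 𝓝 q, c y = 0 → ∀ w, c w = 0 → c (J y w) = 0) :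
    ∃ Z : E → ℂ, (∀ᶠ y in 𝓝 q, ContDiffAt ℝ ∞ Z y) ∧ ∀ᶠ y in 𝓝 q, (Z y = 0 ↔ c y = 0) ∧
      (Z y = 0 → Function.Surjective (fderiv ℝ Z y) ∧
        ∀ w, fderiv ℝ Z y (J y w) = Complex.I * fderiv ℝ Z y w) := by
  obtain ⟨σ₀, hσ₀⟩ := c.toLinearMap.exists_rightInverse_of_surjective (LinearMap.range_eq_top.2 hc)
  set σ : ℂ →L[ℝ] E := σ₀.toContinuousLinearMap
  have hσ : ∀ k, c (σ k) = k := fun k => LinearMap.congr_fun hσ₀ k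
  set R : ℂ →L[ℝ] ℂ := Complex.ofRealCLM.comp Complex.reCLM
  set j : E → ℂ →L[ℝ] ℂ := fun y => c.comp ((J y).comp σ)
  set T : E → ℂ →L[ℝ] ℂ := fun y => R - Complex.I • R.comp (j y)
  have hT : ∀ y k, T y k = (k.re : ℂ) - Complex.I * (j y k).re := fun y k => by simp [T, R]
  have hTs : ∀ᶠ y in 𝓝 q, ContDiffAt ℝ ∞ T y := by
    filter_upwards [hJ] with y hy
    exact contDiffAt_const.sub ((contDiffAt_const.clm_comp (contDiffAt_const.clm_comp
      (hy.clm_comp contDiffAt_const))).const_smul _)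
  -- along `c = 0`, the structure `J` descends to `j` on the normal space
  have hjc : ∀ᶠ y in 𝓝 q, c y = 0 → ∀ w, c (J y w) = j y (c w) := by
    filter_upwards [hinv] with y hy h0 w
    have := hy h0 (w - σ (c w)) (by rw [map_sub, hσ, sub_self])
    rw [map_sub, map_sub, sub_eq_zero] at this
    exact this
  have hjj : ∀ᶠ y in 𝓝 q, c y = 0 → ∀ k, j y (j y k) = -k := by
    filter_upwards [hjc, hJ2] with y h1 h2 h0 k
    have h3 := h1 h0 (J y (σ k))
    rw [h2, map_neg, hσ] at h3
    exact h3.symm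
  have hTinj : ∀ y, (∀ k, j y (j y k) = -k) → Function.Injective (T y) := fun y hy =>
    (injective_iff_map_eq_zero _).2 fun k hk => injective_re_sub_I_mul_re hy (by rwa [← hT])
  obtain ⟨T₀, hT₀⟩ : ∃ T₀ : ℂ ≃L[ℝ] ℂ, (T₀ : ℂ →L[ℝ] ℂ) = T q :=
    ⟨(LinearEquiv.ofInjectiveEndo (T q).toLinearMap
      (hTinj q (hjj.self_of_nhds hcq))).toContinuousLinearEquiv, by ext k; rfl⟩
  have hTe : ∀ᶠ y in 𝓝 q, Function.Bijective (T y) := by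
    have h1 : ContinuousAt T q := hTs.self_of_nhds.continuousAt
    have h2 := ContinuousLinearEquiv.nhds T₀
    rw [hT₀] at h2
    filter_upwards [h1 h2] with y hy
    obtain ⟨T', hT'⟩ := hy
    rw [← hT']
    exact T'.bijective
  refine ⟨fun y => T y (c y), ?_, ?_⟩
  · filter_upwards [hTs] with y hy
    exact hy.clm_apply c.contDiff.contDiffAt
  filter_upwards [hTs, hTe, hjc, hjj] with y h1 h2 h3 h4
  have h0 : T y (c y) = 0 ↔ c y = 0 := map_eq_zero_iff _ h2.injective
  refine ⟨h0, fun hy => ?_⟩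
  have hcy := h0.1 hy
  have hd : fderiv ℝ (fun y => T y (c y)) y = (T y).comp c := by
    have := ((h1.differentiableAt (by simp)).hasFDerivAt.clm_apply c.hasFDerivAt).fderiv
    rw [this]
    ext w
    simp [hcy]
  rw [hd]
  refine ⟨h2.surjective.comp hc, fun w => ?_⟩
  simp only [ContinuousLinearMap.comp_apply]
  rw [h3 hcy, hT, hT, h4 hcy]
  push_cast [Complex.neg_re]
  linear_combination (j y (c w)).re * Complex.I_sq

section Existence

variable {E : Type*} [NormedAddCommGroup E] [NormedSpace ℝ E] [FiniteDimensional ℝ E]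
  {M : Type*} [TopologicalSpace M] [ChartedSpace E M] [IsManifold 𝓘(ℝ, E) ∞ M]
  {J : AlmostComplexStructure E M}
  {F : Type*} [NormedAddCommGroup F] [NormedSpace ℝ F] [FiniteDimensional ℝ F]
  {S : Type*} [TopologicalSpace S] [ChartedSpace F S] {ι : S → M}

/-- Slice charts: near each of its points, an almost complex hypersurface is a linear subspace of
real codimension two in a suitable chart, with tangent spaces invariant under `J`. -/
lemma IsAlmostComplexHypersurface.exists_slice_chart (hι : IsAlmostComplexHypersurface J F ι)
    (s : S) : ∃ e ∈ IsManifold.maximalAtlas 𝓘(ℝ, E) ∞ M, ι s ∈ e.source ∧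
      ∃ c : E →L[ℝ] ℂ, Function.Surjective c ∧
        ∀ᶠ x in 𝓝 (ι s), (x ∈ range ι ↔ c (e x) = 0) ∧
          (x ∈ range ι → ∀ w, c w = 0 → c (J.inChart e (e x) w) = 0) := by
  obtain ⟨C, _, _, h⟩ := hι.embedding.isImmersion.isImmersionAt s
  set e := h.codChart
  set d := h.domChart
  have he : e ∈ IsManifold.maximalAtlas 𝓘(ℝ, E) ∞ M := h.codChart_mem_maximalAtlas
  have hd : d ∈ IsManifold.maximalAtlas 𝓘(ℝ, F) ∞ S := h.domChart_mem_maximalAtlas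
  have hse : ∀ s' ∈ d.source, ι s' ∈ e.source := h.source_subset_preimage_source
  have hsd : s ∈ d.source := h.mem_domChart_source
  have hwr : ∀ a ∈ d.target, e (ι (d.symm a)) = h.equiv (a, 0) := fun a ha => by
    have := h.writtenInCharts
      (show a ∈ (h.domChart.extend 𝓘(ℝ, F)).target by simpa using ha)
    simpa using this
  have hwr' : ∀ s' ∈ d.source, e (ι s') = h.equiv (d s', 0) := fun s' hs' => by
    have := hwr _ (d.map_source hs')
    rwa [d.left_inv hs'] at this
  have hCfd : FiniteDimensional ℝ C := by
    refine FiniteDimensional.of_injective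
      (h.equiv.toLinearEquiv.toLinearMap.comp (LinearMap.inr ℝ F C)) ?_
    exact h.equiv.injective.comp LinearMap.inr_injective
  have hC : Module.finrank ℝ C = Module.finrank ℝ ℂ := by
    have h1 := h.equiv.toLinearEquiv.finrank_eq
    rw [Module.finrank_prod] at h1
    have h2 := hι.codim
    rw [Complex.finrank_real_complex]
    omega
  set θ : C ≃L[ℝ] ℂ := ContinuousLinearEquiv.ofFinrankEq hC
  set c : E →L[ℝ] ℂ := (θ : C →L[ℝ] ℂ).comp
    ((ContinuousLinearMap.snd ℝ F C).comp (h.equiv.symm : E →L[ℝ] F × C)) with hcdef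
  have hc0 : ∀ y, c y = 0 ↔ ∃ a, y = h.equiv (a, 0) := fun y => by
    have h1 : c y = θ (h.equiv.symm y).2 := rfl
    rw [h1, map_eq_zero_iff _ θ.injective]
    refine ⟨fun h2 => ⟨(h.equiv.symm y).1, ?_⟩, ?_⟩
    · rw [← h2, Prod.mk.eta, h.equiv.apply_symm_apply]
    · rintro ⟨a, rfl⟩
      rw [h.equiv.symm_apply_apply]
  refine ⟨e, he, hse s hsd, c, fun k => ⟨h.equiv (0, θ.symm k), by simp [hcdef]⟩, ?_⟩
  obtain ⟨O, hO, hOd⟩ := hι.embedding.isEmbedding.isInducing.isOpen_iff.1 d.open_source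
  have hsO : ι s ∈ O := by
    have : s ∈ ι ⁻¹' O := hOd ▸ hsd
    exact this
  have hfst : ∀ᶠ x in 𝓝 (ι s), (h.equiv.symm (e x)).1 ∈ d.target := by
    have h1 : ContinuousAt (fun x => (h.equiv.symm (e x)).1) (ι s) :=
      (continuous_fst.comp h.equiv.symm.continuous).continuousAt.comp
        (e.continuousAt (hse s hsd))
    refine h1 (d.open_target.mem_nhds ?_)
    show (h.equiv.symm (e (ι s))).1 ∈ d.target
    rw [hwr' s hsd, h.equiv.symm_apply_apply]
    exact d.map_source hsd
  filter_upwards [hfst, hO.mem_nhds hsO, e.open_source.mem_nhds (hse s hsd)] with x h1 h2 h3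
  have hran : x ∈ range ι → ∃ s' ∈ d.source, ι s' = x := by
    rintro ⟨s', rfl⟩
    exact ⟨s', by rw [← hOd]; exact h2, rfl⟩
  refine ⟨⟨fun hx => ?_, fun hx => ?_⟩, fun hx w hw => ?_⟩
  · obtain ⟨s', hs', rfl⟩ := hran hx
    exact (hc0 _).2 ⟨_, hwr' s' hs'⟩
  · obtain ⟨a, ha⟩ := (hc0 _).1 hx
    rw [ha, h.equiv.symm_apply_apply] at h1
    refine ⟨d.symm a, e.injOn (hse _ (d.map_target h1)) h3 ?_⟩
    rw [hwr a h1, ha]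
  · obtain ⟨s', hs', rfl⟩ := hran hx
    -- `w` is the image of a tangent vector of the hypersurface
    obtain ⟨b, rfl⟩ := (hc0 _).1 hw
    have hιd : MDifferentiableAt 𝓘(ℝ, F) 𝓘(ℝ, E) ι s' :=
      (hι.embedding.contMDiff s').mdifferentiableAt (by simp)
    have heι : mfderiv 𝓘(ℝ, F) 𝓘(ℝ, E) (e ∘ ι) s' =
        (mfderiv 𝓘(ℝ, E) 𝓘(ℝ, E) e (ι s')).comp (mfderiv 𝓘(ℝ, F) 𝓘(ℝ, E) ι s') :=
      mfderiv_comp s' ((mdifferentiable_of_mem_maximalAtlas he).mdifferentiableAt h3) hιd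
    let inc : F →L[ℝ] E := (h.equiv : F × C →L[ℝ] E).comp (ContinuousLinearMap.inl ℝ F C)
    have hloc : e ∘ ι =ᶠ[𝓝 s'] inc ∘ d := by
      filter_upwards [d.open_source.mem_nhds hs'] with t ht
      exact hwr' t ht
    have heι' : (mfderiv 𝓘(ℝ, F) 𝓘(ℝ, E) (e ∘ ι) s' : F →L[ℝ] E) =
        inc.comp (mfderiv 𝓘(ℝ, F) 𝓘(ℝ, F) d s') := by
      have h4 : (mfderiv 𝓘(ℝ, F) 𝓘(ℝ, E) (e ∘ ι) s' : F →L[ℝ] E) =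
        mfderiv 𝓘(ℝ, F) 𝓘(ℝ, E) (inc ∘ d) s' := hloc.mfderiv_eq
      have h5 : mfderiv 𝓘(ℝ, F) 𝓘(ℝ, E) (inc ∘ d) s' =
          (mfderiv 𝓘(ℝ, F) 𝓘(ℝ, E) inc (d s')).comp (mfderiv 𝓘(ℝ, F) 𝓘(ℝ, F) d s') :=
        mfderiv_comp s' inc.differentiableAt.mdifferentiableAt
          ((mdifferentiable_of_mem_maximalAtlas hd).mdifferentiableAt hs')
      rw [mfderiv_eq_fderiv, inc.fderiv] at h5
      exact h4.trans h5
    have htan : ∀ v : F, (mfderiv 𝓘(ℝ, E) 𝓘(ℝ, E) e (ι s') : E →L[ℝ] E)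
        ((mfderiv 𝓘(ℝ, F) 𝓘(ℝ, E) ι s' : F →L[ℝ] E) v) =
        inc ((mfderiv 𝓘(ℝ, F) 𝓘(ℝ, F) d s' : F →L[ℝ] F) v) := fun v =>
      (DFunLike.congr_fun heι v).symm.trans (DFunLike.congr_fun heι' v)
    obtain ⟨v, hv⟩ := (mdifferentiable_of_mem_maximalAtlas hd).mfderiv_surjective hs' b
    obtain ⟨v', hv'⟩ := hι.invariant s' v
    have h6 : h.equiv (b, 0) = mfderiv 𝓘(ℝ, E) 𝓘(ℝ, E) e (ι s')
        (mfderiv 𝓘(ℝ, F) 𝓘(ℝ, E) ι s' v) :=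
      ((htan v).trans (congrArg inc hv)).symm
    rw [h6, J.inChart_apply he h3, ← hv']
    exact (hc0 _).2 ⟨_, htan v'⟩

/-- Normal coordinates exist near each point of an almost complex hypersurface. -/
lemma IsAlmostComplexHypersurface.exists_isNormalCoordinate
    (hι : IsAlmostComplexHypersurface J F ι) {p : M} (hp : p ∈ range ι) :
    ∃ U ζ, IsNormalCoordinate J (range ι) p U ζ := by
  obtain ⟨s, rfl⟩ := hp
  obtain ⟨e, he, hes, c, hc, hsl⟩ := hι.exists_slice_chart s
  have ht : Tendsto e.symm (𝓝 (e (ι s))) (𝓝 (ι s)) := by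
    simpa [e.left_inv hes] using (e.continuousAt_symm (e.map_source hes)).tendsto
  have htar := e.open_target.mem_nhds (e.map_source hes)
  have hsl' := ht.eventually hsl
  obtain ⟨Z, hZ, hZ'⟩ := exists_normal_function (J := J.inChart e) (q := e (ι s)) hc
    (hsl.self_of_nhds.1.1 ⟨s, rfl⟩)
    (by filter_upwards [htar] with y hy using J.contDiffAt_inChart he hy)
    (by filter_upwards [htar] with y hy using J.inChart_inChart he hy)
    (by
      filter_upwards [htar, hsl'] with y hy h1 h2
      have h3 := h1.2 (h1.1.2 (by rwa [e.right_inv hy]))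
      rwa [e.right_inv hy] at h3)
  obtain ⟨V, hVs, hV, hpV⟩ := mem_nhds_iff.1 (hZ.and (hZ'.and (hsl'.and htar)))
  refine ⟨_, _, IsNormalCoordinate.of_chart (Z := Z) he hes hV hpV
    (fun y hy => (hVs hy).1.contDiffWithinAt) (fun y hy => ?_)
    (fun y hy h0 => ((hVs hy).2.1.2 h0).1) (fun y hy h0 => ((hVs hy).2.1.2 h0).2)⟩
  have h1 := (hVs hy).2.2.1.1
  rw [e.right_inv (hVs hy).2.2.2] at h1
  rw [(hVs hy).2.1.1, h1]

end Existence

/-! ### Leading monomials and winding numbers -/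

section LeadingMonomial

variable {w : ℂ → ℂ} {z₀ a : ℂ} {m : ℕ}

lemma isEquivalent_leading_monomial (ha : a ≠ 0)
    (h : (fun z => w z - a * (z - z₀) ^ m) =O[𝓝 z₀] fun z => ‖z - z₀‖ ^ (m + 1)) :
    w ~[𝓝 z₀] fun z => a * (z - z₀) ^ m := by
  have h1 : (fun z : ℂ => ‖z - z₀‖ ^ (m + 1)) =o[𝓝 z₀] fun z => (z - z₀) ^ m := by
    have ht : Tendsto (fun z : ℂ => z - z₀) (𝓝 z₀) (𝓝 0) := by
      simpa using (by fun_prop : Continuous fun z : ℂ => z - z₀).tendsto z₀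
    have h2 := ((isLittleO_pow_pow (𝕜 := ℂ) m.lt_succ_self).comp_tendsto ht).norm_left
    simpa [Function.comp_def] using h2
  exact (h.trans_isLittleO h1).trans_isBigO
    ((isBigO_refl _ _).const_mul_right ha)

lemma eventually_ne_zero_of_leading_monomial (ha : a ≠ 0)
    (h : (fun z => w z - a * (z - z₀) ^ m) =O[𝓝 z₀] fun z => ‖z - z₀‖ ^ (m + 1)) :
    ∀ᶠ z in 𝓝[≠] z₀, w z ≠ 0 := by
  have h1 := (isEquivalent_leading_monomial ha h).isBigO_symm.eq_zero_imp
  filter_upwards [h1.filter_mono nhdsWithin_le_nhds, self_mem_nhdsWithin] with z hz hne h0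
  have hne : z ≠ z₀ := hne
  simpa [ha, sub_eq_zero, hne] using hz h0

lemma le_of_leading_monomial_isBigO {w' : ℂ → ℂ} {a' : ℂ} {m' : ℕ} (ha : a ≠ 0) (ha' : a' ≠ 0)
    (h : (fun z => w z - a * (z - z₀) ^ m) =O[𝓝 z₀] fun z => ‖z - z₀‖ ^ (m + 1))
    (h' : (fun z => w' z - a' * (z - z₀) ^ m') =O[𝓝 z₀] fun z => ‖z - z₀‖ ^ (m' + 1))
    (hO : w' =O[𝓝 z₀] w) : m ≤ m' := by
  by_contra hlt
  have h1 : (fun z : ℂ => (z - z₀) ^ m') =O[𝓝 z₀] fun z => (z - z₀) ^ m :=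
    ((((isBigO_refl _ _).const_mul_right ha').trans
      (isEquivalent_leading_monomial ha' h').isBigO_symm).trans hO).trans
      ((isEquivalent_leading_monomial ha h).isBigO.trans ((isBigO_refl _ _).const_mul_left a))
  have ht : Tendsto (fun z : ℂ => z - z₀) (𝓝 z₀) (𝓝 0) := by
    simpa using (by fun_prop : Continuous fun z : ℂ => z - z₀).tendsto z₀
  have h2 : (fun z : ℂ => (z - z₀) ^ m) =o[𝓝 z₀] fun z => (z - z₀) ^ m' :=
    (isLittleO_pow_pow (𝕜 := ℂ) (not_le.1 hlt)).comp_tendsto ht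
  refine isLittleO_irrefl ?_ (h1.trans_isLittleO h2)
  have h3 : ∃ᶠ z in 𝓝[≠] z₀, (z - z₀) ^ m' ≠ 0 := by
    refine Eventually.frequently ?_
    filter_upwards [self_mem_nhdsWithin] with z hz
    exact pow_ne_zero _ (sub_ne_zero.2 hz)
  exact h3.filter_mono nhdsWithin_le_nhds

/-- A function with leading monomial `a (z - z₀) ^ m` winds `m` times around `0` along small
circles about `z₀`: its quotient by the monomial takes values in the slit plane. -/
lemma eventually_hasWindingNumber (ha : a ≠ 0) (hw : ∀ᶠ z in 𝓝 z₀, ContinuousAt w z)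
    (h : (fun z => w z - a * (z - z₀) ^ m) =O[𝓝 z₀] fun z => ‖z - z₀‖ ^ (m + 1)) :
    ∀ᶠ r in 𝓝[>] (0 : ℝ), HasWindingNumber (fun t => w (circleMap z₀ r t)) m := by
  have h1 : (fun z => w z - a * (z - z₀) ^ m) =o[𝓝 z₀] fun z => a * (z - z₀) ^ m :=
    isEquivalent_leading_monomial ha h
  obtain ⟨δ, hδ, hb⟩ := Metric.eventually_nhds_iff_ball.1
    (hw.and (h1.bound (by norm_num : (0 : ℝ) < 1 / 2)))
  filter_upwards [self_mem_nhdsWithin, nhdsWithin_le_nhds (Iio_mem_nhds hδ)] with r hr hrδ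
  have hr : 0 < r := hr
  have hmem : ∀ t, circleMap z₀ r t ∈ Metric.ball z₀ δ := fun t => by
    rw [Metric.mem_ball, dist_eq_norm, circleMap_sub_center, norm_circleMap_zero, abs_of_pos hr]
    exact hrδ
  have hcirc : ∀ t, circleMap z₀ r t - z₀ = r * Complex.exp (t * Complex.I) := fun t => by
    rw [circleMap_sub_center, circleMap_zero]
  set q : ℝ → ℂ := fun t => a * (circleMap z₀ r t - z₀) ^ m
  have hq : ∀ t, q t ≠ 0 := fun t => by
    refine mul_ne_zero ha (pow_ne_zero _ ?_)
    rw [hcirc]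
    exact mul_ne_zero (by exact_mod_cast hr.ne') (Complex.exp_ne_zero _)
  set ρ : ℝ → ℂ := fun t => w (circleMap z₀ r t) / q t
  have hρ : ∀ t, ρ t ∈ Complex.slitPlane := fun t => by
    have h2 := (hb _ (hmem t)).2
    have h3 : ‖ρ t - 1‖ < 1 := by
      have h4 : ρ t - 1 = (w (circleMap z₀ r t) - q t) / q t := by
        rw [sub_div, div_self (hq t)]
      rw [h4, norm_div, div_lt_one (norm_pos_iff.2 (hq t))]
      have := norm_pos_iff.2 (hq t)
      exact h2.trans_lt (by linarith)
    have := Complex.mem_slitPlane_of_norm_lt_one h3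
    rwa [add_sub_cancel] at this
  have hρc : Continuous ρ := by
    refine Continuous.div ?_ ?_ hq
    · exact continuous_iff_continuousAt.2 fun t =>
        ContinuousAt.comp (f := circleMap z₀ r) (hb _ (hmem t)).1
          (continuous_circleMap z₀ r).continuousAt
    · have := continuous_circleMap z₀ r
      fun_prop
  have hwρ : ∀ t, w (circleMap z₀ r t) = q t * ρ t := fun t => (mul_div_cancel₀ _ (hq t)).symm
  refine ⟨fun t => Complex.arg a + m * t + Complex.arg (ρ t), ?_, fun t _ => ?_, ?_⟩
  · have : Continuous fun t => Complex.arg (ρ t) := continuous_iff_continuousAt.2 fun t =>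
      (Complex.continuousAt_arg (hρ t)).comp hρc.continuousAt
    fun_prop
  · have h0 : w (circleMap z₀ r t) ≠ 0 := by
      rw [hwρ]
      exact mul_ne_zero (hq t) (Complex.slitPlane_ne_zero (hρ t))
    refine ⟨h0, ?_⟩
    have hn : ‖w (circleMap z₀ r t)‖ = ‖a‖ * r ^ m * ‖ρ t‖ := by
      rw [hwρ, norm_mul]
      simp only [q]
      rw [norm_mul, norm_pow, circleMap_sub_center, norm_circleMap_zero, abs_of_pos hr]
    have e1 := Complex.norm_mul_exp_arg_mul_I a
    have e2 := Complex.norm_mul_exp_arg_mul_I (ρ t)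
    rw [hn]
    calc w (circleMap z₀ r t)
        = (‖a‖ * Complex.exp (Complex.arg a * Complex.I)) *
            (r * Complex.exp (t * Complex.I)) ^ m *
            (‖ρ t‖ * Complex.exp (Complex.arg (ρ t) * Complex.I)) := by
          rw [e1, e2, hwρ]
          simp only [q]
          rw [hcirc]
      _ = _ := by
          rw [mul_pow, ← Complex.exp_nat_mul]
          push_cast
          rw [add_mul, add_mul, Complex.exp_add, Complex.exp_add]
          ring_nf
  · have : ρ (2 * Real.pi) = ρ 0 := by
      have h5 : circleMap z₀ r (2 * Real.pi) = circleMap z₀ r 0 := by simp [circleMap]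
      simp only [ρ, q, h5]
    simp only [this]
    push_cast
    ring

end LeadingMonomial

lemma HasWindingNumber.unique {γ : ℝ → ℂ} {k k' : ℤ} (h : HasWindingNumber γ k)
    (h' : HasWindingNumber γ k') : k = k' := by
  obtain ⟨θ, hθ, hγ, hk⟩ := h
  obtain ⟨θ', hθ', hγ', hk'⟩ := h'
  have hpi := Real.pi_pos
  have hint : ∀ t ∈ Icc 0 (2 * Real.pi), ∃ n : ℤ, θ t - θ' t = n * (2 * Real.pi) := fun t ht => by
    obtain ⟨h0, h1⟩ := hγ t ht
    have h2 := h1.symm.trans (hγ' t ht).2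
    have h3 : (‖γ t‖ : ℂ) ≠ 0 := by simpa using h0
    obtain ⟨n, hn⟩ := Complex.exp_eq_exp_iff_exists_int.1 (mul_left_cancel₀ h3 h2)
    refine ⟨n, ?_⟩
    have h4 : (θ t : ℂ) = θ' t + n * (2 * Real.pi) := by
      refine mul_right_cancel₀ Complex.I_ne_zero ?_
      rw [hn]; ring
    have h5 : θ t = θ' t + n * (2 * Real.pi) := by exact_mod_cast h4
    linarith
  set δ : ℝ → ℝ := fun t => (θ t - θ' t) / (2 * Real.pi)
  have hδc : Continuous δ := by fun_prop
  have hδ : ∀ t ∈ Icc 0 (2 * Real.pi), δ t ∈ range ((↑) : ℤ → ℝ) := fun t ht => by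
    obtain ⟨n, hn⟩ := hint t ht
    exact ⟨n, by simp only [δ]; rw [hn]; field_simp⟩
  have : DiscreteTopology (range ((↑) : ℤ → ℝ)) :=
    Int.isClosedEmbedding_coe_real.isEmbedding.toHomeomorph.symm.isEmbedding.discreteTopology
  have hconst : δ (2 * Real.pi) = δ 0 :=
    isPreconnected_Icc.constant_of_mapsTo this.isDiscrete hδc.continuousOn hδ
      (right_mem_Icc.2 (by positivity)) (left_mem_Icc.2 (by positivity))
  simp only [δ] at hconst
  rw [div_left_inj' (by positivity), hk, hk'] at hconst
  have h6 : 2 * Real.pi * ((k : ℝ) - k') = 0 := by linarith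
  have h7 : (k : ℝ) - k' = 0 := (mul_eq_zero.1 h6).resolve_left (by positivity)
  exact_mod_cast sub_eq_zero.1 h7

/-! ### Local and global structure of the intersection -/

section Local

variable {E : Type*} [NormedAddCommGroup E] [NormedSpace ℝ E] [FiniteDimensional ℝ E]
  {M : Type*} [TopologicalSpace M] [ChartedSpace E M] [IsManifold 𝓘(ℝ, E) ∞ M]
  {J : AlmostComplexStructure E M} {A : Set M} {u : ℂ → M} {z₀ : ℂ}

/-- Any two normal coordinates near a point are comparable. -/
lemma IsNormalCoordinate.isBigO {p : M} {U U' : Set M} {ζ ζ' : M → ℂ}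
    (h : IsNormalCoordinate J A p U ζ) (h' : IsNormalCoordinate J A p U' ζ') (hp : p ∈ A) :
    ζ' =O[𝓝 p] ζ := by
  have he : chartAt E p ∈ IsManifold.maximalAtlas 𝓘(ℝ, E) ∞ M := IsManifold.chart_mem_maximalAtlas p
  have hpe := mem_chart_source E p
  set e := chartAt E p
  have hs : ∀ {U : Set M} {ζ : M → ℂ}, IsNormalCoordinate J A p U ζ →
      ContDiffAt ℝ 2 (ζ ∘ e.symm) (e p) := fun h =>
    (contDiffAt_comp_chart_symm he hpe (h.contMDiffAt h.mem)).of_le ENat.LEInfty.out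
  obtain ⟨L, hL⟩ := exists_linear_factor (hs h) (hs h')
    ((h.eventually_zero_iff hpe).self_of_nhds.2 (by rwa [e.left_inv hpe]))
    (h.surjective_chart he hpe hp) (by
      filter_upwards [h.eventually_zero_iff hpe, h'.eventually_zero_iff hpe] with y h1 h2 h3
      exact h2.2 (h1.1 h3))
  have h1 : (fun y => ‖y - e p‖ * ‖(ζ ∘ e.symm) y‖) =O[𝓝 (e p)] (ζ ∘ e.symm) := by
    have h2 : (fun y : E => ‖y - e p‖) =O[𝓝 (e p)] fun _ => (1 : ℝ) :=
      (by fun_prop : Continuous fun y : E => ‖y - e p‖).continuousAt.isBigO_one ℝ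
    have h3 := h2.mul (isBigO_refl (ζ ∘ e.symm) (𝓝 (e p))).norm_norm
    simp only [one_mul] at h3
    exact h3.of_norm_right
  have h3 := (hL.trans h1).add (L.isBigO_comp (ζ ∘ e.symm) _)
  have h4 := (h3.congr_left fun y => sub_add_cancel _ _).comp_tendsto (e.continuousAt hpe)
  exact h4.congr' (eventuallyEq_comp_chart hpe ζ').symm (eventuallyEq_comp_chart hpe ζ).symm

/-- The normal component of a pseudoholomorphic curve at an intersection point vanishes
identically near that point or has a leading monomial. -/
lemma IsPseudoholomorphicOn.normal_component_dichotomy {Ω : Set ℂ}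
    (hu : IsPseudoholomorphicOn J u Ω) (hΩ : IsOpen Ω) (hz : z₀ ∈ Ω) (hA : u z₀ ∈ A)
    {U : Set M} {ζ : M → ℂ} (h : IsNormalCoordinate J A (u z₀) U ζ) :
    (∀ᶠ z in 𝓝 z₀, ζ (u z) = 0) ∨ ∃ m : ℕ, 0 < m ∧ ∃ a : ℂ, a ≠ 0 ∧
      (fun z => ζ (u z) - a * (z - z₀) ^ m) =O[𝓝 z₀] fun z => ‖z - z₀‖ ^ (m + 1) := by
  have he : chartAt E (u z₀) ∈ IsManifold.maximalAtlas 𝓘(ℝ, E) ∞ M :=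
    IsManifold.chart_mem_maximalAtlas _
  have hpe := mem_chart_source E (u z₀)
  set e := chartAt E (u z₀)
  have huc : ContinuousAt u z₀ := (hu.contMDiffOn.contMDiffAt (hΩ.mem_nhds hz)).continuousAt
  have hue : ∀ᶠ z in 𝓝 z₀, u z ∈ e.source := huc (e.open_source.mem_nhds hpe)
  have key := eventually_eq_zero_or_leading_monomial_comp (Z := ζ ∘ e.symm)
    (J := J.inChart e) (v := e ∘ u)
    ((contDiffAt_comp_chart_symm he hpe (h.contMDiffAt h.mem)).of_le ENat.LEInfty.out)
    ((J.contDiffAt_inChart he (e.map_source hpe)).of_le ENat.LEInfty.out)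
    (hu.contDiffAt_chart hΩ he hz hpe)
    ((h.eventually_zero_iff hpe).self_of_nhds.2 (by rwa [e.left_inv hpe]))
    (h.surjective_chart he hpe hA) (h.complexLinear_chart he hpe)
    (by
      filter_upwards [hue, hΩ.mem_nhds hz] with z h1 h2
      exact hu.fderiv_chart hΩ he h2 h1)
  have heq : ∀ᶠ z in 𝓝 z₀, (ζ ∘ e.symm) ((e ∘ u) z) = ζ (u z) := by
    filter_upwards [hue] with z h1
    simp [e.left_inv h1]
  rcases key with h1 | ⟨m, hm, a, ha, h1⟩
  · left
    filter_upwards [h1, heq] with z h2 h3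
    rw [← h3, h2]
  · refine Or.inr ⟨m, hm, a, ha, h1.congr' ?_ EventuallyEq.rfl⟩
    filter_upwards [heq] with z h3
    rw [h3]

/-- The description of a single intersection point, given that normal coordinates exist. -/
lemma IsPseudoholomorphicOn.intersection_dichotomy {Ω : Set ℂ}
    (hu : IsPseudoholomorphicOn J u Ω) (hΩ : IsOpen Ω) (hz : z₀ ∈ Ω) (hA : u z₀ ∈ A)
    (hex : ∃ U ζ, IsNormalCoordinate J A (u z₀) U ζ) :
    (∀ᶠ z in 𝓝 z₀, u z ∈ A) ∨ ((∀ᶠ z in 𝓝[≠] z₀, u z ∉ A) ∧ ∃ m : ℕ, 0 < m ∧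
      (∀ k : ℤ, HasIntersectionIndex J A u z₀ k ↔ k = m) ∧
      (∃ (U : Set M) (ζ : M → ℂ), IsNormalCoordinate J A (u z₀) U ζ ∧
        (fun z => ζ (u z) - (z - z₀) ^ m) =O[𝓝 z₀] (fun z => ‖z - z₀‖ ^ (m + 1))) ∧
      (∀ (U : Set M) (ζ : M → ℂ), IsNormalCoordinate J A (u z₀) U ζ →
        ∃ a : ℂ, a ≠ 0 ∧
          (fun z => ζ (u z) - a * (z - z₀) ^ m) =O[𝓝 z₀] (fun z => ‖z - z₀‖ ^ (m + 1)))) := by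
  obtain ⟨U, ζ, h⟩ := hex
  have hus : ∀ᶠ z in 𝓝 z₀, ContinuousAt u z := by
    filter_upwards [hΩ.mem_nhds hz] with z hz
    exact (hu.contMDiffOn.contMDiffAt (hΩ.mem_nhds hz)).continuousAt
  have huc := hus.self_of_nhds
  have hzero : ∀ᶠ z in 𝓝 z₀, ζ (u z) = 0 ↔ u z ∈ A := by
    filter_upwards [huc (h.isOpen.mem_nhds h.mem)] with z hz
    exact h.eq_zero_iff _ hz
  rcases hu.normal_component_dichotomy hΩ hz hA h with h0 | ⟨m, hm, a, ha, hexp⟩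
  · left
    filter_upwards [h0, hzero] with z h1 h2
    exact h2.1 h1
  right
  have hne := eventually_ne_zero_of_leading_monomial ha hexp
  -- every normal coordinate gives the same order, as they are all comparable
  have hall : ∀ (U : Set M) (ζ : M → ℂ), IsNormalCoordinate J A (u z₀) U ζ →
      ∃ a : ℂ, a ≠ 0 ∧
        (fun z => ζ (u z) - a * (z - z₀) ^ m) =O[𝓝 z₀] (fun z => ‖z - z₀‖ ^ (m + 1)) := by
    intro U' ζ' h'
    rcases hu.normal_component_dichotomy hΩ hz hA h' with h0 | ⟨m', -, a', ha', hexp'⟩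
    · have h1 : ∀ᶠ z in 𝓝 z₀, ζ (u z) = 0 := by
        filter_upwards [h0, hzero, huc (h'.isOpen.mem_nhds h'.mem)] with z h1 h2 h3
        exact h2.2 ((h'.eq_zero_iff _ h3).1 h1)
      obtain ⟨z, h2, h3⟩ := (hne.and (h1.filter_mono nhdsWithin_le_nhds)).exists
      exact absurd h3 h2
    · have h1 : m ≤ m' :=
        le_of_leading_monomial_isBigO ha ha' hexp hexp' ((h.isBigO h' hA).comp_tendsto huc)
      have h2 : m' ≤ m :=
        le_of_leading_monomial_isBigO ha' ha hexp' hexp ((h'.isBigO h hA).comp_tendsto huc)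
      obtain rfl := le_antisymm h1 h2
      exact ⟨a', ha', hexp'⟩
  have hwind : ∀ (U : Set M) (ζ : M → ℂ), IsNormalCoordinate J A (u z₀) U ζ →
      ∀ᶠ r in 𝓝[>] (0 : ℝ), HasWindingNumber (fun t => ζ (u (circleMap z₀ r t))) m := by
    intro U' ζ' h'
    obtain ⟨a', ha', hexp'⟩ := hall U' ζ' h'
    refine eventually_hasWindingNumber (w := fun z => ζ' (u z)) ha' ?_ hexp'
    filter_upwards [hus, huc (h'.isOpen.mem_nhds h'.mem)] with z h1 h2
    exact (h'.contMDiffAt h2).continuousAt.comp h1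
  refine ⟨?_, m, hm, fun k => ⟨fun hk => ?_, ?_⟩, ?_, hall⟩
  · filter_upwards [hne, hzero.filter_mono nhdsWithin_le_nhds] with z h1 h2 h3
    exact h1 (h2.2 h3)
  · obtain ⟨r, h1, h2⟩ := ((hk U ζ h).and (hwind U ζ h)).exists
    exact h1.unique h2
  · rintro rfl
    exact hwind
  · refine ⟨U, fun x => a⁻¹ * ζ x, h.const_mul (inv_ne_zero ha), ?_⟩
    refine (hexp.const_mul_left a⁻¹).congr_left fun z => ?_
    field_simp

end Local

theorem lemma3
    {E : Type*} [NormedAddCommGroup E] [NormedSpace ℝ E] [FiniteDimensional ℝ E]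
    {M : Type*} [TopologicalSpace M] [ChartedSpace E M] [IsManifold 𝓘(ℝ, E) ∞ M]
    (J : AlmostComplexStructure E M)
    {F : Type*} [NormedAddCommGroup F] [NormedSpace ℝ F] [FiniteDimensional ℝ F]
    {S : Type*} [TopologicalSpace S] [ChartedSpace F S] [IsManifold 𝓘(ℝ, F) ∞ S]
    (ι : S → M) (hι : IsAlmostComplexHypersurface J F ι) (hclosed : IsClosed (range ι))
    -- the unit disc `D`, open or closed
    (D : Set ℂ) (hD : D = Metric.ball (0 : ℂ) 1 ∨ D = Metric.closedBall (0 : ℂ) 1)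
    (u : ℂ → M) (hcont : ContinuousOn u D)
    (hu : IsPseudoholomorphicOn J u (Metric.ball (0 : ℂ) 1)) :
    (∀ z ∈ D, u z ∈ range ι) ∨
      -- the intersection points in the open disc form a discrete set without limit points there
      (IsDiscrete (Metric.ball (0 : ℂ) 1 ∩ u ⁻¹' range ι) ∧
        (∀ z ∈ Metric.ball (0 : ℂ) 1,
          ¬ AccPt z (𝓟 (Metric.ball (0 : ℂ) 1 ∩ u ⁻¹' range ι))) ∧
        ∀ z₀ ∈ Metric.ball (0 : ℂ) 1 ∩ u ⁻¹' range ι, ∃ m : ℕ, 0 < m ∧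
          -- the intersection index at `z₀` is well defined and equal to `m`
          (∀ k : ℤ, HasIntersectionIndex J (range ι) u z₀ k ↔ k = m) ∧
          -- some normal coordinate puts the normal component in normal form
          (∃ (U : Set M) (ζ : M → ℂ), IsNormalCoordinate J (range ι) (u z₀) U ζ ∧
            (fun z => ζ (u z) - (z - z₀) ^ m) =O[𝓝 z₀] (fun z => ‖z - z₀‖ ^ (m + 1))) ∧
          -- and every normal coordinate does so up to a nonzero constant
          (∀ (U : Set M) (ζ : M → ℂ), IsNormalCoordinate J (range ι) (u z₀) U ζ →
            ∃ a : ℂ, a ≠ 0 ∧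
              (fun z => ζ (u z) - a * (z - z₀) ^ m) =O[𝓝 z₀]
                (fun z => ‖z - z₀‖ ^ (m + 1)))) := by
  set B : Set ℂ := Metric.ball 0 1
  have hB : IsOpen B := Metric.isOpen_ball
  have huc : ∀ z ∈ B, ContinuousAt u z := fun z hz =>
    (hu.contMDiffOn.contMDiffAt (hB.mem_nhds hz)).continuousAt
  have hloc := fun z₀ (hz : z₀ ∈ B) (hA : u z₀ ∈ range ι) =>
    hu.intersection_dichotomy hB hz hA (hι.exists_isNormalCoordinate hA)
  have hBD : B ⊆ D := by
    rcases hD with rfl | rfl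
    exacts [subset_rfl, Metric.ball_subset_closedBall]
  have hDB : D ⊆ closure B := by
    rw [closure_ball _ one_ne_zero]
    rcases hD with rfl | rfl
    exacts [Metric.ball_subset_closedBall, subset_rfl]
  by_cases hI : (B ∩ interior (u ⁻¹' range ι)).Nonempty
  · left
    -- the interior of `u⁻¹(Σ)` is relatively closed in the disc
    have hsub : B ⊆ interior (u ⁻¹' range ι) := by
      refine (convex_ball (0 : ℂ) 1).isPreconnected.subset_of_closure_inter_subset
        isOpen_interior hI ?_
      rintro z ⟨hzc, hz⟩
      by_contra hzI
      have hfr : ∃ᶠ y in 𝓝[≠] z, u y ∈ range ι := by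
        have h1 : ∃ᶠ y in 𝓝 z, y ≠ z ∧ y ∈ interior (u ⁻¹' range ι) :=
          (mem_closure_iff_frequently.1 hzc).mono fun y hy => ⟨by rintro rfl; exact hzI hy, hy⟩
        rw [nhdsWithin, frequently_inf_principal]
        exact h1.mono fun y hy => ⟨hy.1, (interior_subset hy.2 : y ∈ u ⁻¹' range ι)⟩
      have hzA : u z ∈ range ι :=
        hclosed.mem_of_frequently_of_tendsto (hfr.filter_mono nhdsWithin_le_nhds) (huc z hz)
      rcases hloc z hz hzA with h1 | ⟨h1, -⟩
      · exact hzI (mem_interior_iff_mem_nhds.2 h1)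
      · exact hfr h1
    intro z hz
    have hmaps : MapsTo u B (range ι) := fun y hy =>
      (interior_subset (hsub hy) : y ∈ u ⁻¹' range ι)
    have h1 : u z ∈ closure (range ι) := ((hcont z hz).mono hBD).mem_closure (hDB hz) hmaps
    rwa [hclosed.closure_eq] at h1
  · right
    have hiso := fun z₀ (hz : z₀ ∈ B) (hA : u z₀ ∈ range ι) => (hloc z₀ hz hA).resolve_left
      fun h => hI ⟨z₀, hz, mem_interior_iff_mem_nhds.2 h⟩
    have hacc : ∀ z ∈ B, ¬ AccPt z (𝓟 (B ∩ u ⁻¹' range ι)) := fun z hz h => by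
      rw [accPt_iff_frequently_nhdsNE] at h
      have hfr : ∃ᶠ y in 𝓝[≠] z, u y ∈ range ι := h.mono fun y hy => hy.2
      exact hfr (hiso z hz (hclosed.mem_of_frequently_of_tendsto
        (hfr.filter_mono nhdsWithin_le_nhds) (huc z hz))).1
    refine ⟨⟨discreteTopology_subtype_iff.2 fun z hz => ?_⟩, hacc, fun z₀ hz =>
      (hiso z₀ hz.1 hz.2).2⟩
    exact not_neBot.1 (hacc z hz.1)
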